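/- Let $K$ be a field, $R=K[x_1,\dots,x_n]$, and let $\Delta$ be a $1$-dimensional simplicial complex on the vertex set $\{1,\dots,n\}$ (all $\{i\}$ are faces) that is a forest, i.e. every connected component is a tree: each nonempty set $T$ of facets of the component contains a leaf, that is, a facet $F\in T$ such that $T=\{F\}$ or there is $G\in T$, $G\ne F$, with $F\cap H\subseteq F\cap G$ for all $H\in T$, $H\neq F$. Let $I=(x_ix_j : \{i,j\} \text{ an edge of }\Delta)$ be the edge ideal of $\Delta$ (if $\Delta$ has no isolated vertices, this is the ideal generated by the squarefree monomials of the facets of $\Delta$). Let $H_\bullet(R/I)=Z_\bullet(R/I)/B_\bullet(R/I)$ be the homology of the Koszul complex of $R/I$ with respect to $x_1,\dots,x_n$, an algebra under the product induced by the exterior product; let $e_1,\dots,e_n$ be the standard basis in degree $1$ and $e_L=e_{l_1}\wedge\dots\wedge e_{l_r}$ for $L=\{l_1<\dots<l_r\}$. A linear monomial cycle is a Koszul cycle of the form $z=fe_L$, where $L\subseteq\{1,\dots,n\}$ and $f$ is a monomial of degree $d-1$, $d$ being the least degree of a generator of $I$ (here $d=2$). Then: (i) $\operatorname{reg}(R/I)$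 is the maximal number $j\ge 0$ for which there exist linear monomial cycles $z_1,\dots,z_j$ such that $[z_1]\cdots[z_j]\neq 0$ in $H_\bullet(R/I)$; (ii) $\operatorname{pd}(R/I)$ is the maximum among the sums $\sum_{i=1}^j k_i$ for which there exist linear monomial cycles $z_i\in Z_{k_i}(R/I)$, $i=1,\dots,j$, such that $[z_1]\cdots[z_j]\ne 0$ in $H_\bullet(R/I)$. Here $\operatorname{reg}(R/I)=\max\{j-i : b_{ij}(R/I)\neq 0\}$, where $b_{ij}(R/I)$ is the number of generators of degree $j$ of the $i$-th module in a minimal graded free resolution of $R/I$ over $R$, and $\operatorname{pd}$ is the projective dimension over $R$. -/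

import Mathlib

open MvPolynomial

noncomputable section

namespace FacetIdeal

/-! ### Simplicial complexes, trees and forests

Mathlib's `AbstractSimplicialComplex V` contains all singletons `{v}`; its faces are the nonempty
faces (the empty face is left out by convention). -/

section Complexes

variable {V : Type*}

/-- The facets of `Δ`, i.e. its faces that are maximal under inclusion. -/
def facets (Δ : AbstractSimplicialComplex V) : Set (Finset V) :=
  {F | Maximal (fun G => G ∈ Δ.faces) F}

/-- `dim Δ = d`, where a face `F` has dimension `|F| - 1`. -/
def HasDimension (Δ : AbstractSimplicialComplex V) (d : ℕ) : Prop :=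
  IsGreatest {k : ℕ | ∃ F ∈ Δ.faces, F.card = k + 1} d

/-! A subcomplex of `Δ` (in the sense used for facet ideals) is given by a subset of the facets of
`Δ`. The next notions are therefore stated for a set `S` of facets. -/

/-- `F` and `G` are joined by a chain `F = F₀, …, F_m = G` of members of `S` such that consecutive
members meet. -/
def ChainJoined (S : Set (Finset V)) (F G : Finset V) : Prop :=
  Relation.ReflTransGen (fun A B => A ∈ S ∧ B ∈ S ∧ ∃ v, v ∈ A ∧ v ∈ B) F G

/-- Any two facets are joined by a chain. -/
def IsConnected (S : Set (Finset V)) : Prop :=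
  ∀ F ∈ S, ∀ G ∈ S, ChainJoined S F G

/-- `F` is a leaf: it is the only facet, or there is another facet `G` such that
`F ∩ H ⊆ F ∩ G` for all facets `H ≠ F`. -/
def IsLeaf (S : Set (Finset V)) (F : Finset V) : Prop :=
  F ∈ S ∧ (S = {F} ∨ ∃ G ∈ S, G ≠ F ∧ ∀ H ∈ S, H ≠ F → ∀ v ∈ F, v ∈ H → v ∈ G)

/-- A tree (in the sense of Faridi): connected, and every nonempty subcomplex has a leaf. -/
def IsTree (S : Set (Finset V)) : Prop :=
  IsConnected S ∧ ∀ T : Set (Finset V), T ⊆ S → T.Nonempty → ∃ F, IsLeaf T F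

/-- The connected component of `Δ` that contains the facet `F`. -/
def component (Δ : AbstractSimplicialComplex V) (F : Finset V) : Set (Finset V) :=
  {G | G ∈ facets Δ ∧ ChainJoined (facets Δ) F G}

/-- A forest: every connected component is a tree. -/
def IsForest (Δ : AbstractSimplicialComplex V) : Prop :=
  ∀ F ∈ facets Δ, IsTree (component Δ F)

end Complexes

/-! ### Edge ideals and monomial ideals -/

section Ideals

variable (K : Type*) [Field K] {n : ℕ}

/-- The ideal generated by the squarefree monomials `∏ v ∈ F, x_v`, `F` a facet of `Δ`. -/
def facetIdeal (Δ : AbstractSimplicialComplex (Fin n)) : Ideal (MvPolynomial (Fin n) K) :=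
  Ideal.span {f | ∃ F ∈ facets Δ, f = ∏ v ∈ F, X v}

/-- The ideal generated by the monomials `x_i x_j`, `{i, j}` an edge (a `1`-dimensional face)
of `Δ`. -/
def edgeIdeal (Δ : AbstractSimplicialComplex (Fin n)) : Ideal (MvPolynomial (Fin n) K) :=
  Ideal.span {f | ∃ F ∈ Δ.faces, F.card = 2 ∧ f = ∏ v ∈ F, X v}

/-- For a `1`-dimensional complex all of whose facets are edges, the edge ideal is the
facet ideal. -/
theorem edgeIdeal_eq_facetIdeal (Δ : AbstractSimplicialComplex (Fin n))
    (hdim : HasDimension Δ 1) (hpure : ∀ F ∈ facets Δ, F.card = 2) :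
    edgeIdeal K Δ = facetIdeal K Δ := by
  unfold edgeIdeal facetIdeal
  congr 1
  ext f
  constructor
  · rintro ⟨F, hF, hc, rfl⟩
    refine ⟨F, ⟨hF, fun G hG hFG => ?_⟩, rfl⟩
    have hle : G.card ≤ 2 := by
      have hpos : 0 < G.card := Finset.card_pos.2 (Δ.isRelLowerSet_faces hG).1
      have := hdim.2 (show G.card - 1 ∈ _ from ⟨G, hG, by omega⟩)
      omega
    exact (Finset.eq_of_subset_of_card_le hFG (by omega)).ge
  · rintro ⟨F, hF, rfl⟩
    exact ⟨F, hF.1, hpure F hF, rfl⟩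

variable {K}

/-- The exponents of the monomials in the unique minimal set `G(I)` of monomial generators of a
monomial ideal `I`: those monomials in `I` that are minimal under divisibility. -/
def minimalGenerators (I : Ideal (MvPolynomial (Fin n) K)) : Set (Fin n →₀ ℕ) :=
  {m | Minimal (fun m' => monomial m' (1 : K) ∈ I) m}

/-- The least degree of the generators of a (nonzero) monomial ideal. -/
def leastGeneratorDegree (I : Ideal (MvPolynomial (Fin n) K)) : ℕ :=
  sInf {d | ∃ m ∈ minimalGenerators I, Finsupp.degree m = d}

end Ideals

/-! ### The Koszul complex `K(x₁, …, xₙ; R/I)` and its homology algebra -/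

section Koszul

/-! The contraction of the exterior algebra with a linear form is an antiderivation. -/

section Contraction

variable {S M : Type*} [CommRing S] [AddCommGroup M] [Module S M]

theorem contractLeft_involute (d : Module.Dual S M) (a : ExteriorAlgebra S M) :
    CliffordAlgebra.contractLeft d (CliffordAlgebra.involute a) =
      -CliffordAlgebra.involute (CliffordAlgebra.contractLeft d a) := by
  induction a using CliffordAlgebra.left_induction with
  | algebraMap r => simp
  | add x y hx hy => simp only [map_add, hx, hy, neg_add]
  | ι_mul x m hx =>
    simp [CliffordAlgebra.contractLeft_ι_mul, hx, sub_eq_add_neg, add_comm]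

theorem contractLeft_mul (d : Module.Dual S M) (a b : ExteriorAlgebra S M) :
    CliffordAlgebra.contractLeft d (a * b) = CliffordAlgebra.contractLeft d a * b +
      CliffordAlgebra.involute a * CliffordAlgebra.contractLeft d b := by
  induction a using CliffordAlgebra.left_induction with
  | algebraMap r => simp [CliffordAlgebra.contractLeft_algebraMap_mul]
  | add x y hx hy => simp only [map_add, add_mul, hx, hy]; abel
  | ι_mul x m hx =>
    simp only [mul_assoc, CliffordAlgebra.contractLeft_ι_mul, hx, map_mul,
      CliffordAlgebra.involute_ι, mul_add, sub_mul, smul_mul_assoc, neg_mul]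
    abel

end Contraction

variable {K : Type*} [Field K] {n : ℕ} (I : Ideal (MvPolynomial (Fin n) K))

/-- The underlying algebra of the Koszul complex of `R/I` with respect to `x₁, …, xₙ`: the exterior
algebra of the free `R/I`-module with basis `e₁, …, eₙ`. -/
abbrev KoszulAlgebra : Type _ :=
  ExteriorAlgebra (MvPolynomial (Fin n) K ⧸ I) (Fin n → MvPolynomial (Fin n) K ⧸ I)

/-- The Koszul differential: the contraction with the linear form `e_i ↦ x_i`, that is
`d(e_{i₁} ∧ ⋯ ∧ e_{i_r}) = ∑ₖ (-1)^(k+1) x_{i_k} e_{i₁} ∧ ⋯ ê_{i_k} ⋯ ∧ e_{i_r}`. -/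
def koszulD : KoszulAlgebra I →ₗ[MvPolynomial (Fin n) K ⧸ I] KoszulAlgebra I :=
  CliffordAlgebra.contractLeft
    (Fintype.linearCombination (MvPolynomial (Fin n) K ⧸ I)
      (fun i : Fin n => Ideal.Quotient.mk I (X i)))

theorem koszulD_mul (a b : KoszulAlgebra I) :
    koszulD I (a * b) = koszulD I a * b + CliffordAlgebra.involute a * koszulD I b :=
  contractLeft_mul _ a b

theorem koszulD_involute (a : KoszulAlgebra I) :
    koszulD I (CliffordAlgebra.involute a) = -CliffordAlgebra.involute (koszulD I a) :=
  contractLeft_involute _ a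

theorem koszulD_koszulD (a : KoszulAlgebra I) : koszulD I (koszulD I a) = 0 :=
  CliffordAlgebra.contractLeft_contractLeft _ a

/-- The Koszul cycles `Z(R/I) = ker d`, a subalgebra. -/
def koszulCycles : Subalgebra (MvPolynomial (Fin n) K ⧸ I) (KoszulAlgebra I) where
  carrier := {z | koszulD I z = 0}
  mul_mem' {a b} ha hb := by
    simp only [Set.mem_ofPred_eq] at ha hb ⊢
    rw [koszulD_mul, ha, hb, zero_mul, mul_zero, add_zero]
  add_mem' {a b} ha hb := by
    simp only [Set.mem_ofPred_eq] at ha hb ⊢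
    rw [map_add, ha, hb, add_zero]
  algebraMap_mem' r := by
    simp only [Set.mem_ofPred_eq]
    exact CliffordAlgebra.contractLeft_algebraMap (Q := 0) _ r

theorem mem_koszulCycles {z : KoszulAlgebra I} : z ∈ koszulCycles I ↔ koszulD I z = 0 := by
  change z ∈ {z | koszulD I z = 0} ↔ _
  simp only [Set.mem_ofPred_eq]

/-- The Koszul boundaries `B(R/I) = im d`, an ideal in the algebra of cycles. -/
def koszulBoundaries : Ideal (koszulCycles I) where
  carrier := {z | ∃ w, koszulD I w = z}
  zero_mem' := ⟨0, by simp⟩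
  add_mem' := by
    rintro a b ⟨u, hu⟩ ⟨v, hv⟩
    exact ⟨u + v, by simp [hu, hv]⟩
  smul_mem' := by
    rintro ⟨a, ha⟩ ⟨b, hb'⟩ ⟨v, hv⟩
    refine ⟨CliffordAlgebra.involute a * v, ?_⟩
    have ha' : koszulD I a = 0 := (mem_koszulCycles I).1 ha
    rw [koszulD_mul, koszulD_involute, ha', hv, CliffordAlgebra.involute_involute]
    simp

instance : (koszulBoundaries I).IsTwoSided where
  mul_mem_of_left {a} b := by
    rintro ⟨v, hv⟩
    refine ⟨v * b, ?_⟩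
    have hb : koszulD I (b : KoszulAlgebra I) = 0 := (mem_koszulCycles I).1 b.2
    rw [koszulD_mul, hb, hv]
    simp

/-- The Koszul homology `H(R/I) = Z(R/I) / B(R/I)`, with the multiplication induced by the exterior
product. -/
abbrev KoszulHomology : Type _ := koszulCycles I ⧸ koszulBoundaries I

/-- The homology class `[z]` of a Koszul cycle `z`. -/
def homologyClass (z : koszulCycles I) : KoszulHomology I :=
  Ideal.Quotient.mk (koszulBoundaries I) z

/-- `z ∈ Z_k(R/I)`: the cycle `z` is homogeneous of homological degree `k`. -/
def HasHomologicalDegree (k : ℕ) (z : koszulCycles I) : Prop :=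
  (z : KoszulAlgebra I) ∈
    ⋀[MvPolynomial (Fin n) K ⧸ I]^k (Fin n → MvPolynomial (Fin n) K ⧸ I)

/-- `e_L = e_{l₁} ∧ ⋯ ∧ e_{l_r}` for `L = {l₁ < ⋯ < l_r}`. -/
def koszulBasis (L : Finset (Fin n)) : KoszulAlgebra I :=
  ((L.sort (· ≤ ·)).map fun i => ExteriorAlgebra.ι (MvPolynomial (Fin n) K ⧸ I)
    (Pi.single i 1 : Fin n → MvPolynomial (Fin n) K ⧸ I)).prod

/-- A linear monomial cycle: a cycle of the form `f e_L` with `f` a monomial of degree `d - 1`,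
where `d` is the least degree of the generators of `I`. -/
def IsLinearMonomialCycle (z : koszulCycles I) : Prop :=
  ∃ (m : Fin n →₀ ℕ) (L : Finset (Fin n)), Finsupp.degree m + 1 = leastGeneratorDegree I ∧
    (z : KoszulAlgebra I) = Ideal.Quotient.mk I (monomial m 1) • koszulBasis I L

end Koszul

/-! ### Castelnuovo-Mumford regularity -/

section Regularity

variable {K : Type*} [Field K] {n : ℕ}

/-- A minimal graded free resolution
`⋯ ⟶ F₂ ⟶ F₁ ⟶ F₀ ⟶ R/I ⟶ 0` of `R/I` over `R = K[x₁, …, xₙ]`, where `I` is a homogeneous ideal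
and `F_i = ⨁_p R(-degree i p)` has finite rank. All shifts are natural numbers because `R/I` lives
in nonnegative degrees. -/
structure MinimalGradedFreeResolution (I : Ideal (MvPolynomial (Fin n) K)) where
  /-- the rank of `F_i` -/
  rank : ℕ → ℕ
  /-- the degree of the `p`-th basis element of `F_i` -/
  degree : (i : ℕ) → Fin (rank i) → ℕ
  /-- the augmentation `F₀ → R/I` -/
  aug : (Fin (rank 0) → MvPolynomial (Fin n) K) →ₗ[MvPolynomial (Fin n) K]
    MvPolynomial (Fin n) K ⧸ I
  /-- the differential `F_{i+1} → F_i` -/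
  d : (i : ℕ) → (Fin (rank (i + 1)) → MvPolynomial (Fin n) K) →ₗ[MvPolynomial (Fin n) K]
    (Fin (rank i) → MvPolynomial (Fin n) K)
  /-- the augmentation preserves degrees -/
  aug_homogeneous : ∀ p, ∃ f : MvPolynomial (Fin n) K, f.IsHomogeneous (degree 0 p) ∧
    aug (Pi.single p 1) = Ideal.Quotient.mk I f
  /-- the differentials preserve degrees: the matrix entries are zero or homogeneous of
  degree `degree (i + 1) q - degree i p` -/
  d_homogeneous : ∀ i q p, d i (Pi.single q 1) p = 0 ∨
    ∃ k, degree i p + k = degree (i + 1) q ∧ (d i (Pi.single q 1) p).IsHomogeneous k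
  aug_surjective : Function.Surjective aug
  exact_zero : Function.Exact (d 0) aug
  exact_succ : ∀ i, Function.Exact (d (i + 1)) (d i)
  /-- minimality: the matrix entries lie in the maximal ideal `(x₁, …, xₙ)` -/
  minimal : ∀ i q p, d i (Pi.single q 1) p ∈
    Ideal.span (Set.range (X : Fin n → MvPolynomial (Fin n) K))

/-- `reg (R/I) = r`, i.e. `r = max {j - i | b_{ij}(R/I) ≠ 0}`, where the graded Betti number
`b_{ij}(R/I)` is the number of basis elements of degree `j` in the `i`-th module of a minimal graded
free resolution of `R/I`. (Such a resolution is unique up to isomorphism of graded complexes.) -/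
def HasRegularity (I : Ideal (MvPolynomial (Fin n) K)) (r : ℤ) : Prop :=
  ∃ F : MinimalGradedFreeResolution I,
    IsGreatest {s : ℤ | ∃ (i : ℕ) (p : Fin (F.rank i)), s = (F.degree i p : ℤ) - i} r

end Regularity

end FacetIdeal

end

/-! Write `I` as the edge ideal of the forest `H` formed by the edges of `Δ`. Everything rests on
removing a leaf `v` with neighbour `w`. Put `J = I(H - v)`, so that `I = J + (x_v x_w)`. The colon
ideal `Q = J : x_v x_w = J : x_w` is generated by the edges of `H - N[w]` and the variables in `N(w)
\ {v}`. The exact sequence `0 → R/Q → R/J → R/I → 0` then compares the invariants of the three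
rings.

Multiplication by `x_w` already maps `Q` into `J`, so multiplication by `x_v x_w` lifts to `x_v`
times a chain map of resolutions. The entries of this lift lie in the maximal ideal, and its mapping
cone is a minimal resolution of `R/I` (`CyclicResolution.exists_cone`). Hence `reg(R/I) =
max(reg(R/J), reg(R/Q) + 1)`, while `pd(R/I) ≤ max(pd(R/J), pd(R/Q) + 1)`. Each variable in `Q`
raises the projective dimension bound by one and leaves the regularity alone. Unwinding the
recursion (`exists_hasInvariants_and_starFamily`) gives families of stars `(w, v, N(w))`: one with
as many members as the regularity, and one whose total number of rays is the bound for the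
projective dimension.

A star gives the linear monomial cycle `x_w e_L`, `L` its set of rays. Products over a star family
are not boundaries (`starFamily_not_boundary`): contraction removes all rays except the chosen
leaves, and what remains belongs to an induced matching and is detected by an explicit functional
(`matchingFunctional_boundary`, `matchingFunctional_single`).

For the opposite inequalities, a product of `j` linear monomial cycles has coefficients of degree
`j`, and Koszul homology vanishes in coefficient degrees above the regularity
(`IsMonomialStep.koszulVanishesAbove`). It also vanishes in homological degrees above the projective
dimension (`exists_coordD_eq_of_hasProjectiveDimensionLT`). The latter, applied to a nonzero star
product, shows that the bound for `pd` is attained. -/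

open MvPolynomial

noncomputable section

namespace FacetIdeal

/-! ### Exterior calculus on coordinate vectors indexed by finite sets. -/

section Coordinates

variable {n : ℕ} {M : Type*} [AddCommGroup M]

/-- The sign with which `e_s` enters `e_T`: `(-1)` to the number of elements of `T` below `s`. -/
def wedgeSign (s : Fin n) (T : Finset (Fin n)) : ℤ := (-1) ^ (T.filter (· < s)).card

theorem wedgeSign_mul_self (s : Fin n) (T : Finset (Fin n)) :
    wedgeSign s T * wedgeSign s T = 1 := by
  unfold wedgeSign
  rw [← pow_add, ← two_mul, pow_mul]
  simp

theorem wedgeSign_smul_smul (s : Fin n) (T : Finset (Fin n)) (m : M) :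
    wedgeSign s T • wedgeSign s T • m = m := by
  rw [smul_smul, wedgeSign_mul_self, one_smul]

theorem wedgeSign_insert {s t : Fin n} {T : Finset (Fin n)} (hs : s ∉ T) :
    wedgeSign t (insert s T) = if s < t then -wedgeSign t T else wedgeSign t T := by
  unfold wedgeSign
  rw [Finset.filter_insert]
  split_ifs with h
  · rw [Finset.card_insert_of_notMem (by simp [hs]), pow_succ]; ring
  · rfl

theorem wedgeSign_erase {s t : Fin n} {T : Finset (Fin n)} (hs : s ∈ T) :
    wedgeSign t (T.erase s) = if s < t then -wedgeSign t T else wedgeSign t T := by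
  have h := wedgeSign_insert (t := t) (Finset.notMem_erase s T)
  rw [Finset.insert_erase hs] at h
  split_ifs at h ⊢ <;> simp [h]

/-- The contraction with the dual basis vector `e_s^*`, in coordinates. -/
def coordContract (s : Fin n) : (Finset (Fin n) → M) →+ (Finset (Fin n) → M) where
  toFun z T := if s ∈ T then 0 else wedgeSign s T • z (insert s T)
  map_zero' := by ext; simp
  map_add' a b := by ext T; by_cases h : s ∈ T <;> simp [h]

/-- The left multiplication with the basis vector `e_s`, in coordinates. -/
def coordWedge (s : Fin n) : (Finset (Fin n) → M) →+ (Finset (Fin n) → M) where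
  toFun z T := if s ∈ T then wedgeSign s T • z (T.erase s) else 0
  map_zero' := by ext; simp
  map_add' a b := by ext T; by_cases h : s ∈ T <;> simp [h]

theorem coordContract_apply (s : Fin n) (z : Finset (Fin n) → M) (T : Finset (Fin n)) :
    coordContract s z T = if s ∈ T then 0 else wedgeSign s T • z (insert s T) := rfl

theorem coordWedge_apply (s : Fin n) (z : Finset (Fin n) → M) (T : Finset (Fin n)) :
    coordWedge s z T = if s ∈ T then wedgeSign s T • z (T.erase s) else 0 := rfl

theorem coordContract_self (s : Fin n) (z : Finset (Fin n) → M) :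
    coordContract s (coordContract s z) = 0 := by
  ext T
  simp [coordContract_apply]

theorem coordWedge_self (s : Fin n) (z : Finset (Fin n) → M) :
    coordWedge s (coordWedge s z) = 0 := by
  ext T
  simp [coordWedge_apply]

theorem coordContract_comm {s t : Fin n} (hst : s ≠ t) (z : Finset (Fin n) → M) :
    coordContract s (coordContract t z) = -coordContract t (coordContract s z) := by
  ext T
  by_cases hs : s ∈ T
  · simp [coordContract_apply, hs]
  by_cases ht : t ∈ T
  · simp [coordContract_apply, ht]
  simp only [coordContract_apply, hs, ht, Finset.mem_insert, hst, hst.symm, or_self, if_false,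
    Pi.neg_apply, smul_smul, wedgeSign_insert hs, wedgeSign_insert ht, Finset.insert_comm s t]
  rcases lt_or_gt_of_ne hst with h | h
  · simp [h, h.not_gt, mul_comm]
  · simp [h, h.not_gt, mul_comm]

theorem coordWedge_comm {s t : Fin n} (hst : s ≠ t) (z : Finset (Fin n) → M) :
    coordWedge s (coordWedge t z) = -coordWedge t (coordWedge s z) := by
  ext T
  by_cases hs : s ∈ T
  swap
  · simp [coordWedge_apply, hs]
  by_cases ht : t ∈ T
  swap
  · simp [coordWedge_apply, ht]
  simp only [coordWedge_apply, hs, ht, Finset.mem_erase, hst, hst.symm, if_true, ne_eq,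
    not_false_eq_true, and_self, Pi.neg_apply, smul_smul, wedgeSign_erase hs, wedgeSign_erase ht,
    Finset.erase_right_comm (a := s) (b := t)]
  rcases lt_or_gt_of_ne hst with h | h
  · simp [h, h.not_gt, mul_comm]
  · simp [h, h.not_gt, mul_comm]

/-- Together with `coordContract_wedge_self` these are the Clifford relations between contractions
and wedges; all later homotopy formulas are formal consequences of them. -/
theorem coordContract_wedge {s t : Fin n} (hst : s ≠ t) (z : Finset (Fin n) → M) :
    coordContract s (coordWedge t z) = -coordWedge t (coordContract s z) := by
  ext T
  by_cases hs : s ∈ T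
  · simp [coordContract_apply, coordWedge_apply, hs, hst]
  by_cases ht : t ∈ T
  swap
  · simp [coordContract_apply, coordWedge_apply, ht, hst.symm]
  simp only [coordContract_apply, coordWedge_apply, hs, ht, Finset.mem_insert, Finset.mem_erase,
    hst.symm, if_true, if_false, or_true, and_false, Pi.neg_apply, smul_smul,
    wedgeSign_insert hs, wedgeSign_erase ht, Finset.erase_insert_of_ne hst]
  rcases lt_or_gt_of_ne hst with h | h
  · simp [h, h.not_gt, mul_comm]
  · simp [h, h.not_gt, mul_comm]

theorem coordContract_wedge_self (s : Fin n) (z : Finset (Fin n) → M) :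
    coordContract s (coordWedge s z) = z - coordWedge s (coordContract s z) := by
  ext T
  by_cases hs : s ∈ T
  · have := wedgeSign_erase (t := s) hs
    rw [if_neg (lt_irrefl _)] at this
    simp [coordContract_apply, coordWedge_apply, hs, this, wedgeSign_smul_smul,
      Finset.insert_erase hs]
  · have := wedgeSign_insert (t := s) hs
    rw [if_neg (lt_irrefl _)] at this
    simp [coordContract_apply, coordWedge_apply, hs, this, wedgeSign_smul_smul,
      Finset.erase_insert hs]

theorem coordWedge_contract_self (s : Fin n) (z : Finset (Fin n) → M) (T : Finset (Fin n)) :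
    coordWedge s (coordContract s z) T = if s ∈ T then z T else 0 := by
  by_cases hs : s ∈ T
  · have := wedgeSign_erase (t := s) hs
    rw [if_neg (lt_irrefl _)] at this
    simp [coordContract_apply, coordWedge_apply, hs, this, wedgeSign_smul_smul,
      Finset.insert_erase hs]
  · simp [coordWedge_apply, hs]

/-- Additive maps on the coefficients. -/
def mapCoord {N : Type*} [AddCommGroup N] (f : M →+ N) :
    (Finset (Fin n) → M) →+ (Finset (Fin n) → N) where
  toFun z T := f (z T)
  map_zero' := by ext; simp
  map_add' a b := by ext T; simp

theorem mapCoord_apply {N : Type*} [AddCommGroup N] (f : M →+ N) (z : Finset (Fin n) → M)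
    (T : Finset (Fin n)) : mapCoord f z T = f (z T) := rfl

theorem coordContract_mapCoord {N : Type*} [AddCommGroup N] (f : M →+ N)
    (s : Fin n) (z : Finset (Fin n) → M) :
    coordContract s (mapCoord f z) = mapCoord f (coordContract s z) := by
  ext T
  simp only [coordContract_apply, mapCoord_apply]
  split_ifs <;> simp

theorem coordWedge_mapCoord {N : Type*} [AddCommGroup N] (f : M →+ N)
    (s : Fin n) (z : Finset (Fin n) → M) :
    coordWedge s (mapCoord f z) = mapCoord f (coordWedge s z) := by
  ext T
  simp only [coordWedge_apply, mapCoord_apply]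
  split_ifs <;> simp

theorem coordContract_smul {A : Type*} [Ring A] [Module A M] (a : A) (s : Fin n)
    (z : Finset (Fin n) → M) : coordContract s (a • z) = a • coordContract s z :=
  coordContract_mapCoord (DistribSMul.toAddMonoidHom M a) s z

theorem coordWedge_smul {A : Type*} [Ring A] [Module A M] (a : A) (s : Fin n)
    (z : Finset (Fin n) → M) : coordWedge s (a • z) = a • coordWedge s z :=
  coordWedge_mapCoord (DistribSMul.toAddMonoidHom M a) s z

/-- The common reason for `d ∘ d = 0` and for `v ∧ v = 0`: the terms cancel in pairs under swapping
the indices. -/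
theorem sum_sum_eq_zero_of_alternating (a : Fin n → Fin n → M) (h0 : ∀ s, a s s = 0)
    (h : ∀ s t, s ≠ t → a s t = -a t s) : ∑ s, ∑ t, a s t = 0 := by
  rw [← Fintype.sum_prod_type']
  refine Finset.sum_involution (fun p _ => p.swap) ?_ ?_ (by simp) (by simp)
  · rintro ⟨s, t⟩ -
    by_cases hst : s = t
    · subst hst; simp [h0]
    · simp [h s t hst]
  · rintro ⟨s, t⟩ - hne heq
    simp only [Prod.swap_prod_mk, Prod.mk.injEq] at heq
    exact hne (by simp [heq.1, h0])

end Coordinates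

/-! ### The Koszul complex in coordinates, and its acyclicity over the polynomial ring. -/

section CoordinateComplex

variable {K : Type*} [Field K] {n : ℕ}
variable {M N : Type*} [AddCommGroup M] [Module (MvPolynomial (Fin n) K) M]
  [AddCommGroup N] [Module (MvPolynomial (Fin n) K) N]

variable (K) in
/-- The differential of the Koszul complex `K(x₁, …, xₙ; M)` in coordinates: a family
`z : Finset (Fin n) → M` stands for `∑ T, z T • e_T`. -/
def coordD : (Finset (Fin n) → M) →+ (Finset (Fin n) → M) where
  toFun z := ∑ s, (X s : MvPolynomial (Fin n) K) • coordContract s z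
  map_zero' := by simp
  map_add' a b := by simp [Finset.sum_add_distrib]

theorem coordD_def (z : Finset (Fin n) → M) :
    coordD K z = ∑ s, (X s : MvPolynomial (Fin n) K) • coordContract s z := rfl

theorem coordD_apply (z : Finset (Fin n) → M) (T : Finset (Fin n)) :
    coordD K z T = ∑ s, (X s : MvPolynomial (Fin n) K) •
      (if s ∈ T then 0 else wedgeSign s T • z (insert s T)) := by
  simp [coordD_def, coordContract_apply]

theorem coordD_coordD (z : Finset (Fin n) → M) : coordD K (coordD K z) = 0 := by
  simp only [coordD_def, map_sum, coordContract_smul, smul_smul]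
  refine sum_sum_eq_zero_of_alternating _ (fun s => ?_) fun s t hst => ?_
  · rw [coordContract_self, smul_zero]
  · rw [coordContract_comm hst.symm, smul_neg, mul_comm]

theorem coordD_mapCoord (f : M →ₗ[MvPolynomial (Fin n) K] N) (z : Finset (Fin n) → M) :
    coordD K (mapCoord f.toAddMonoidHom z) = mapCoord f.toAddMonoidHom (coordD K z) := by
  simp only [coordD_def, coordContract_mapCoord, map_sum]
  refine Finset.sum_congr rfl fun s _ => ?_
  ext T
  simp [mapCoord_apply]

theorem coordD_smul (a : MvPolynomial (Fin n) K) (z : Finset (Fin n) → M) :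
    coordD K (a • z) = a • coordD K z :=
  coordD_mapCoord (LinearMap.lsmul (MvPolynomial (Fin n) K) M a) z

theorem coordD_mem (N : Submodule (MvPolynomial (Fin n) K) M) (z : Finset (Fin n) → M)
    (h : ∀ T, z T ∈ N) (T : Finset (Fin n)) : coordD K z T ∈ N := by
  rw [coordD_apply]
  refine sum_mem fun s _ => N.smul_mem _ ?_
  split_ifs
  · exact N.zero_mem
  · exact zsmul_mem (h _) _

/-- The wedge with `e_s` is a null-homotopy of multiplication by `x_s`. -/
theorem coordD_wedge (s : Fin n) (z : Finset (Fin n) → M) :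
    coordD K (coordWedge s z) =
      (X s : MvPolynomial (Fin n) K) • z - coordWedge s (coordD K z) := by
  rw [coordD_def, coordD_def, map_sum, sub_eq_add_neg, ← Finset.sum_neg_distrib,
    ← Finset.sum_erase_add _ _ (Finset.mem_univ s),
    ← Finset.sum_erase_add Finset.univ (fun t => -coordWedge s _) (Finset.mem_univ s),
    coordContract_wedge_self, coordWedge_smul, smul_sub]
  rw [Finset.sum_congr rfl (g := fun t => -coordWedge s
    ((X t : MvPolynomial (Fin n) K) • coordContract t z))]
  · abel
  · intro t ht
    rw [coordContract_wedge (Finset.ne_of_mem_erase ht), coordWedge_smul, smul_neg]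

theorem coordD_congr_card {k : ℕ} {y z : Finset (Fin n) → M}
    (h : ∀ T, k ≤ T.card → y T = z T) (T : Finset (Fin n)) (hT : k ≤ T.card + 1) :
    coordD K y T = coordD K z T := by
  rw [coordD_apply, coordD_apply]
  refine Finset.sum_congr rfl fun s _ => ?_
  split_ifs with hs
  · rfl
  · rw [h _ (by rwa [Finset.card_insert_of_notMem hs])]

theorem coordD_eq_zero_of_card {k : ℕ} {z : Finset (Fin n) → M}
    (h : ∀ T, T.card < k → z T = 0) (T : Finset (Fin n)) (hT : T.card + 1 < k) :
    coordD K z T = 0 := by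
  rw [coordD_apply]
  refine Finset.sum_eq_zero fun s _ => ?_
  split_ifs with hs
  · rw [smul_zero]
  · rw [h _ (by rwa [Finset.card_insert_of_notMem hs]), smul_zero, smul_zero]

/-- Boundaries that vanish in low homological degrees have preimages that do so. -/
theorem exists_coordD_eq_of_card {k : ℕ} {u y : Finset (Fin n) → M} (hu : coordD K y = u)
    (hk : ∀ T, T.card < k → u T = 0) :
    ∃ y', coordD K y' = u ∧ ∀ T, T.card < k + 1 → y' T = 0 := by
  refine ⟨fun T => if T.card < k + 1 then 0 else y T, ?_, fun T hT => by simp [hT]⟩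
  ext T
  by_cases hT : T.card < k
  · rw [hk T hT, coordD_congr_card (k := 0) (z := fun T => if T.card < k + 1 then 0 else y T)
      (fun _ _ => rfl) T (by omega), coordD_apply]
    refine Finset.sum_eq_zero fun s _ => ?_
    split_ifs with hs h
    · simp
    · simp
    · rw [Finset.card_insert_of_notMem hs] at h; omega
  · rw [← hu]
    refine coordD_congr_card (k := k + 1) (fun T hT => ?_) T (by omega)
    rw [if_neg (by omega)]

/-! ### Acyclicity of the Koszul complex of the polynomial ring -/

/-- The additive map `f ↦ (f - f|_{x_s = 0}) / x_s`. -/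
def divX (s : Fin n) : MvPolynomial (Fin n) K →+ MvPolynomial (Fin n) K where
  toFun f := f.divMonomial (Finsupp.single s 1)
  map_zero' := by simp
  map_add' a b := add_divMonomial a b _

theorem coeff_divX (s : Fin n) (f : MvPolynomial (Fin n) K) (m : Fin n →₀ ℕ) :
    coeff m (divX s f) = coeff (Finsupp.single s 1 + m) f := rfl

theorem divX_X_mul_self (s : Fin n) (f : MvPolynomial (Fin n) K) : divX s (X s * f) = f :=
  X_mul_divMonomial s f

theorem divX_X_mul {s t : Fin n} (h : s ≠ t) (f : MvPolynomial (Fin n) K) :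
    divX s (X t * f) = X t * divX s f := by
  ext m
  rw [coeff_divX, coeff_X_mul', coeff_X_mul', coeff_divX]
  have h1 : (t ∈ (Finsupp.single s 1 + m).support) ↔ t ∈ m.support := by
    simp [h]
  simp only [h1]
  split_ifs with h2
  · congr 1
    ext i
    simp only [Finsupp.coe_tsub, Finsupp.coe_add, Pi.sub_apply, Pi.add_apply]
    have : m t ≠ 0 := by simpa using h2
    by_cases hi : i = t
    · subst hi; simp [h]
    · simp [Finsupp.single_apply, Ne.symm hi]
  · rfl

theorem coeff_sub_X_mul_divX (s : Fin n) (f : MvPolynomial (Fin n) K) (m : Fin n →₀ ℕ) :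
    coeff m (f - X s * divX s f) = if m s = 0 then coeff m f else 0 := by
  rw [coeff_sub, coeff_X_mul', coeff_divX]
  by_cases h : m s = 0
  · simp [h]
  · have : Finsupp.single s 1 ≤ m := by simpa [Finsupp.single_le_iff, Nat.one_le_iff_ne_zero] using h
    simp [h, add_tsub_cancel_of_le this]

/-- `divX s` commutes with every `x_t`, `t ≠ s`, but is only a left inverse of `x_s`. The last two
terms are the defect coming from the summand of index `s`. -/
theorem coordD_divX (s : Fin n) (z : Finset (Fin n) → MvPolynomial (Fin n) K) :
    coordD K (mapCoord (divX s) z) = mapCoord (divX s) (coordD K z) - coordContract s z +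
      (X s : MvPolynomial (Fin n) K) • mapCoord (divX s) (coordContract s z) := by
  rw [coordD_def, coordD_def, map_sum, ← Finset.sum_erase_add _ _ (Finset.mem_univ s),
    ← Finset.sum_erase_add Finset.univ (fun t => mapCoord (divX s) _) (Finset.mem_univ s)]
  have h1 : mapCoord (divX s) ((X s : MvPolynomial (Fin n) K) • coordContract s z) =
      coordContract s z := by
    ext1 T
    simp [mapCoord_apply, divX_X_mul_self]
  rw [h1, coordContract_mapCoord, add_sub_cancel_right]
  congr 1
  refine Finset.sum_congr rfl fun t ht => ?_
  rw [coordContract_mapCoord]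
  ext1 T
  simp [mapCoord_apply, divX_X_mul (Finset.ne_of_mem_erase ht).symm]

/-- The homotopy `e_s ∧ divX s` replaces a cycle by a homologous one that involves neither `e_s` nor
`x_s`. -/
theorem cycle_sub_boundary (s : Fin n) {z : Finset (Fin n) → MvPolynomial (Fin n) K}
    (hz : coordD K z = 0) (T : Finset (Fin n)) :
    (z - coordD K (coordWedge s (mapCoord (divX s) z))) T =
      if s ∈ T then 0 else z T - X s * divX s (z T) := by
  have h : z - coordD K (coordWedge s (mapCoord (divX s) z)) =
      (z - coordWedge s (coordContract s z)) - (X s : MvPolynomial (Fin n) K) •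
        mapCoord (divX s) (z - coordWedge s (coordContract s z)) := by
    rw [coordD_wedge, coordD_divX, hz, map_zero, zero_sub, map_add, map_neg, coordWedge_smul,
      coordWedge_mapCoord, map_sub, smul_sub]
    abel
  rw [h]
  simp only [Pi.sub_apply, Pi.smul_apply, mapCoord_apply, smul_eq_mul, coordWedge_contract_self]
  split_ifs <;> simp

/-- Eliminating the variables one by one leaves only the constant coefficient at `∅`. This must be
assumed zero because `H_0 = K`. -/
theorem exists_coordD_eq {z : Finset (Fin n) → MvPolynomial (Fin n) K}
    (hz : coordD K z = 0) (h0 : coeff 0 (z ∅) = 0) : ∃ y, coordD K y = z := by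
  -- After treating the variables in `A`, no term of the remaining cycle involves them. The clause
  -- for `(∅, 0)` is carried along so that for `A = univ` nothing is left.
  suffices H : ∀ A : Finset (Fin n), ∃ y, ∀ T, ∀ m : Fin n →₀ ℕ,
      ((∃ s ∈ A, s ∈ T ∨ m s ≠ 0) ∨ (T = ∅ ∧ m = 0)) → 
        coeff m ((z - coordD K y : Finset (Fin n) → MvPolynomial (Fin n) K) T) = 0 by
    obtain ⟨y, hy⟩ := H Finset.univ
    refine ⟨y, (sub_eq_zero.1 ?_).symm⟩
    ext T m
    rw [hy T m]
    · simp
    · by_contra! hcon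
      apply hcon.2
      · ext s; simpa using (hcon.1 s (Finset.mem_univ s)).1
      · ext s; simpa using (hcon.1 s (Finset.mem_univ s)).2
  intro A
  induction A using Finset.induction_on with
  | empty =>
    refine ⟨0, ?_⟩
    rintro T m (⟨s, hs, -⟩ | ⟨rfl, rfl⟩)
    · simp at hs
    · simpa using h0
  | insert s A _ ih =>
    obtain ⟨y, hy⟩ := ih
    set z' := z - coordD K y with hz'
    have hz'0 : coordD K z' = 0 := by rw [hz', map_sub, hz, coordD_coordD, sub_zero]
    refine ⟨y + coordWedge s (mapCoord (divX s) z'), fun T m hm => ?_⟩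
    rw [map_add, ← sub_sub, ← hz', cycle_sub_boundary s hz'0]
    split_ifs with hs
    · simp
    · rw [coeff_sub_X_mul_divX]
      split_ifs with hms
      · apply hy
        rcases hm with ⟨t, ht, h⟩ | h
        · rcases Finset.mem_insert.1 ht with rfl | ht
          · tauto
          · exact Or.inl ⟨t, ht, h⟩
        · exact Or.inr h
      · rfl

end CoordinateComplex

/-! ### Vanishing of Koszul homology above the projective dimension. -/

section ProjectiveDimension

universe u

open CategoryTheory

theorem exists_coordD_eq_free {K : Type*} [Field K] {n k : ℕ}
    {z : Finset (Fin n) → Fin k → MvPolynomial (Fin n) K}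
    (hz : coordD K z = 0) (h0 : z ∅ = 0) : ∃ y, coordD K y = z := by
  have H : ∀ j : Fin k, ∃ y, coordD K y =
      mapCoord (LinearMap.proj (R := MvPolynomial (Fin n) K) j).toAddMonoidHom z := by
    intro j
    apply exists_coordD_eq
    · rw [coordD_mapCoord, hz, map_zero]
    · simp [mapCoord_apply, h0]
  choose y hy using H
  refine ⟨fun T j => y j T, ?_⟩
  ext1 T
  funext j
  have h1 := congrFun (coordD_mapCoord (K := K)
    (LinearMap.proj (R := MvPolynomial (Fin n) K) j) (fun T j => y j T)) T
  have h2 := congrFun (hy j) T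
  exact h1.symm.trans h2

/-- The Koszul homology of a finitely generated module vanishes above its projective dimension. -/
theorem exists_coordD_eq_of_hasProjectiveDimensionLT {K : Type u} [Field K] {n : ℕ} (p : ℕ) :
    ∀ (M : Type u) [AddCommGroup M] [Module (MvPolynomial (Fin n) K) M]
      [Module.Finite (MvPolynomial (Fin n) K) M],
      HasProjectiveDimensionLT (ModuleCat.of (MvPolynomial (Fin n) K) M) p →
      ∀ z : Finset (Fin n) → M, coordD K z = 0 → (∀ T, T.card < p → z T = 0) →
        ∃ y, coordD K y = z := by
  induction p with
  | zero =>
    intro M _ _ _ hM z hz hk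
    have := (hasProjectiveDimensionLT_zero_iff_isZero _).1 hM
    have : Subsingleton M := ModuleCat.subsingleton_of_isZero this
    exact ⟨0, Subsingleton.elim _ _⟩
  | succ p ih =>
    intro M _ _ _ hM z hz hk
    obtain ⟨k, f, hf⟩ := Module.Finite.exists_fin' (MvPolynomial (Fin n) K) M
    -- A projective module is a direct summand of a free one, where `exists_coordD_eq_free` applies.
    -- Otherwise the dimension is shifted to the kernel of a free cover.
    rcases p with _ | p
    · have hproj : Projective (ModuleCat.of (MvPolynomial (Fin n) K) M) :=
        projective_iff_hasProjectiveDimensionLT_one.2 hM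
      have : Module.Projective (MvPolynomial (Fin n) K) M :=
        (IsProjective.iff_projective _).2 hproj
      obtain ⟨g, hg⟩ := Module.projective_lifting_property f LinearMap.id hf
      obtain ⟨y, hy⟩ := exists_coordD_eq_free (K := K) (z := mapCoord g.toAddMonoidHom z)
        (by rw [coordD_mapCoord, hz, map_zero]) (by rw [mapCoord_apply, hk ∅ (by simp), map_zero])
      refine ⟨mapCoord f.toAddMonoidHom y, ?_⟩
      rw [coordD_mapCoord, hy]
      ext T
      exact LinearMap.congr_fun hg (z T)
    · let S : ShortComplex (ModuleCat (MvPolynomial (Fin n) K)) :=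
        ShortComplex.mk (ModuleCat.ofHom (LinearMap.ker f).subtype) (ModuleCat.ofHom f)
          (by ext x; exact x.2)
      have hS : S.ShortExact :=
        { exact := (ShortComplex.moduleCat_exact_iff S).2 fun x hx => ⟨⟨x, hx⟩, rfl⟩
          mono_f := (ModuleCat.mono_iff_injective _).2 Subtype.val_injective
          epi_g := (ModuleCat.epi_iff_surjective _).2 hf }
      have hfree : Projective S.X₂ :=
        (IsProjective.iff_projective (R := MvPolynomial (Fin n) K)
          (Fin k → MvPolynomial (Fin n) K)).1 inferInstance
      have hker : HasProjectiveDimensionLT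
          (ModuleCat.of (MvPolynomial (Fin n) K) (LinearMap.ker f)) (p + 1) :=
        (hS.hasProjectiveDimensionLT_X₃_iff p hfree).1 hM
      choose l hl using hf
      -- The lift is cut off in low homological degrees, so that its boundary, a cycle with values
      -- in the kernel, also vanishes in low degrees.
      let z' : Finset (Fin n) → Fin k → MvPolynomial (Fin n) K :=
        fun T => if T.card < p + 2 then 0 else l (z T)
      have hz' : mapCoord f.toAddMonoidHom z' = z := by
        ext T
        simp only [mapCoord_apply, z']
        split_ifs with h
        · rw [map_zero, hk T h]
        · exact hl _
      have hker' : ∀ T, coordD K z' T ∈ LinearMap.ker f := fun T => by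
        have := congrFun (coordD_mapCoord (K := K) f z') T
        rw [hz', hz] at this
        exact this.symm
      have hlow : ∀ T : Finset (Fin n), T.card < p + 1 →
          (⟨coordD K z' T, hker' T⟩ : LinearMap.ker f) = 0 := fun T hT => by
        apply Subtype.val_injective
        exact coordD_eq_zero_of_card (K := K) (k := p + 2) (fun T hT => if_pos hT) T (by omega)
      -- The connecting homomorphism: `d z'` is a cycle over the kernel, one homological degree
      -- lower, and hence a boundary there.
      obtain ⟨y, hy⟩ := ih (LinearMap.ker f) hker (fun T => ⟨coordD K z' T, hker' T⟩)
        (by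
          ext1 T
          apply Subtype.val_injective
          have h1 := congrFun (coordD_mapCoord (K := K) (LinearMap.ker f).subtype
            (fun T => ⟨coordD K z' T, hker' T⟩)) T
          refine h1.symm.trans ?_
          exact congrFun (coordD_coordD z') T) hlow
      -- The primitive is truncated so that the corrected cycle `z' - y` vanishes at `∅`, as
      -- exactness over the free module requires.
      obtain ⟨y, hy, hy0⟩ := exists_coordD_eq_of_card hy hlow
      have hsub : coordD K (mapCoord (LinearMap.ker f).subtype.toAddMonoidHom y) =
          coordD K z' := by
        rw [coordD_mapCoord, hy]
        rfl
      obtain ⟨w, hw⟩ := exists_coordD_eq_free (K := K)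
        (z := z' - mapCoord (LinearMap.ker f).subtype.toAddMonoidHom y)
        (by rw [map_sub, hsub, sub_self])
        (by simp [z', mapCoord_apply, hy0 ∅ (by simp)])
      refine ⟨mapCoord f.toAddMonoidHom w, ?_⟩
      rw [coordD_mapCoord, hw, map_sub, hz', sub_eq_self]
      ext T
      exact (y T).2

end ProjectiveDimension

/-! ### Identification of the exterior algebra with coordinate vectors. -/

section ExteriorCoordinates

variable {S : Type*} [CommRing S] {n : ℕ}

/-- `coordWedge` as a linear endomorphism. -/
def coordWedgeHom (s : Fin n) : Module.End S (Finset (Fin n) → S) where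
  toFun := coordWedge s
  map_add' := map_add _
  map_smul' a z := coordWedge_smul a s z

theorem coordWedgeHom_apply (s : Fin n) (z : Finset (Fin n) → S) :
    coordWedgeHom s z = coordWedge s z := rfl

theorem coordWedge_linearCombination_sq (v : Fin n → S) (z : Finset (Fin n) → S) :
    ∑ s, v s • coordWedge s (∑ t, v t • coordWedge t z) = 0 := by
  simp only [map_sum, coordWedge_smul, Finset.smul_sum, smul_smul]
  refine sum_sum_eq_zero_of_alternating _ (fun s => ?_) fun s t hst => ?_
  · rw [coordWedge_self, smul_zero]
  · rw [coordWedge_comm hst, smul_neg, mul_comm]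

variable (S n) in
/-- The action of the exterior algebra on coordinate vectors. -/
def coordAction : ExteriorAlgebra S (Fin n → S) →ₐ[S] Module.End S (Finset (Fin n) → S) :=
  ExteriorAlgebra.lift S ⟨Fintype.linearCombination S (coordWedgeHom (S := S) (n := n)), by
    intro v
    apply LinearMap.ext
    intro z
    have := coordWedge_linearCombination_sq v z
    simpa only [Fintype.linearCombination_apply, coordWedgeHom_apply, Module.End.mul_apply,
      LinearMap.sum_apply, LinearMap.smul_apply, LinearMap.zero_apply] using this⟩

/-- The coordinate vector of an element of the exterior algebra. -/
def coord : ExteriorAlgebra S (Fin n → S) →ₗ[S] (Finset (Fin n) → S) :=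
  (LinearMap.applyₗ (Pi.single ∅ 1)).comp (coordAction S n).toLinearMap

theorem coord_one : coord (1 : ExteriorAlgebra S (Fin n → S)) = Pi.single ∅ 1 := by
  simp [coord]

theorem coord_ι_mul (v : Fin n → S) (a : ExteriorAlgebra S (Fin n → S)) :
    coord (ExteriorAlgebra.ι S v * a) = ∑ s, v s • coordWedge s (coord a) := by
  simp [coord, coordAction, Fintype.linearCombination_apply, coordWedgeHom_apply]

theorem coord_ι_single_mul (i : Fin n) (a : ExteriorAlgebra S (Fin n → S)) :
    coord (ExteriorAlgebra.ι S (Pi.single i 1 : Fin n → S) * a) = coordWedge i (coord a) := by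
  rw [coord_ι_mul, Finset.sum_eq_single i]
  · simp
  · intro j _ hj; simp [hj]
  · simp

theorem exteriorAlgebra_left_induction {P : ExteriorAlgebra S (Fin n → S) → Prop}
    (one : P 1) (smul : ∀ (r : S) x, P x → P (r • x)) (add : ∀ x y, P x → P y → P (x + y))
    (ι_mul : ∀ x i, P x → P (ExteriorAlgebra.ι S (Pi.single i 1 : Fin n → S) * x))
    (a : ExteriorAlgebra S (Fin n → S)) : P a := by
  have zero : P 0 := by simpa using smul 0 1 one
  have sum : ∀ (t : Finset (Fin n)) (f : Fin n → ExteriorAlgebra S (Fin n → S)),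
      (∀ i, P (f i)) → P (∑ i ∈ t, f i) := fun t f hf =>
    Finset.sum_induction f P add zero fun i _ => hf i
  refine CliffordAlgebra.left_induction 0 (fun r => ?_) add (fun x v hx => ?_) a
  · have := smul r 1 one
    rwa [← Algebra.algebraMap_eq_smul_one] at this
  · have hv : ExteriorAlgebra.ι S v * x =
        ∑ i, v i • (ExteriorAlgebra.ι S (Pi.single i 1 : Fin n → S) * x) := by
      conv_lhs => rw [pi_eq_sum_univ' v, map_sum, Finset.sum_mul]
      simp only [map_smul, smul_mul_assoc]
    have := sum Finset.univ _ fun i => smul (v i) _ (ι_mul x i hx)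
    rwa [← hv] at this

theorem coord_contractLeft (θ : Module.Dual S (Fin n → S)) (a : ExteriorAlgebra S (Fin n → S)) :
    coord (CliffordAlgebra.contractLeft θ a) =
      ∑ s, θ (Pi.single s 1) • coordContract s (coord a) := by
  induction a using exteriorAlgebra_left_induction with
  | one =>
    have h : CliffordAlgebra.contractLeft θ (1 : ExteriorAlgebra S (Fin n → S)) = 0 :=
      CliffordAlgebra.contractLeft_one 0 θ
    rw [h, map_zero, coord_one]
    symm
    refine Finset.sum_eq_zero fun s _ => ?_
    have h2 : coordContract s (Pi.single ∅ 1 : Finset (Fin n) → S) = 0 := by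
      ext T
      simp [coordContract_apply]
    rw [h2, smul_zero]
  | smul r x hx => simp only [map_smul, hx, Finset.smul_sum, coordContract_smul, smul_comm r]
  | add x y hx hy => simp only [map_add, hx, hy, smul_add, Finset.sum_add_distrib]
  | ι_mul a t ha =>
    have h := CliffordAlgebra.contractLeft_ι_mul (Q := 0) (d := θ) (Pi.single t 1) a
    change CliffordAlgebra.contractLeft θ (ExteriorAlgebra.ι S (Pi.single t 1) * a) =
      θ (Pi.single t 1) • a -
        ExteriorAlgebra.ι S (Pi.single t 1) * CliffordAlgebra.contractLeft θ a at h
    rw [h, map_sub, map_smul, coord_ι_single_mul, coord_ι_single_mul, ha]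
    simp only [map_sum, coordWedge_smul]
    rw [← Finset.sum_erase_add _ _ (Finset.mem_univ t),
      ← Finset.sum_erase_add Finset.univ (fun s => θ (Pi.single s 1) •
        coordContract s (coordWedge t (coord a))) (Finset.mem_univ t),
      coordContract_wedge_self, smul_sub]
    rw [Finset.sum_congr rfl (g := fun s => -(θ (Pi.single s 1) •
      coordContract s (coordWedge t (coord a))))]
    · simp only [Finset.sum_neg_distrib]; abel
    · intro s hs
      rw [coordContract_wedge (Finset.ne_of_mem_erase hs), smul_neg, neg_neg]

theorem coord_apply_eq_zero_of_mem_exteriorPower (k : ℕ) :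
    ∀ a ∈ ⋀[S]^k (Fin n → S), ∀ T : Finset (Fin n), T.card ≠ k → coord a T = 0 := by
  induction k with
  | zero =>
    intro a ha T hT
    rw [ExteriorAlgebra.exteriorPower, pow_zero] at ha
    obtain ⟨r, rfl⟩ := Submodule.mem_one.1 ha
    rw [Algebra.algebraMap_eq_smul_one, map_smul, coord_one]
    have : T ≠ ∅ := by rintro rfl; simp at hT
    simp [this]
  | succ k ih =>
    intro a ha T hT
    rw [ExteriorAlgebra.exteriorPower, pow_succ'] at ha
    induction ha using Submodule.mul_induction_on' with
    | mem_mul_mem x hx y hy =>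
      obtain ⟨v, rfl⟩ := hx
      rw [coord_ι_mul, Finset.sum_apply]
      refine Finset.sum_eq_zero fun s _ => ?_
      rw [Pi.smul_apply, coordWedge_apply]
      split_ifs with hs
      · rw [ih y hy, smul_zero, smul_zero]
        rw [Finset.card_erase_of_mem hs]
        have := Finset.card_pos.2 ⟨s, hs⟩
        omega
      · rw [smul_zero]
    | add x _ y _ hx hy => rw [map_add, Pi.add_apply, hx, hy, add_zero]

/-- The products `e_L` in the exterior algebra of a free module. -/
def wedgeBasis (S : Type*) [CommRing S] {n : ℕ} (L : Finset (Fin n)) :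
    ExteriorAlgebra S (Fin n → S) :=
  ((L.sort (· ≤ ·)).map fun i => ExteriorAlgebra.ι S (Pi.single i 1 : Fin n → S)).prod

theorem wedgeBasis_empty : wedgeBasis S (∅ : Finset (Fin n)) = 1 := by simp [wedgeBasis]

theorem wedgeBasis_insert {s : Fin n} {T : Finset (Fin n)} (h : ∀ t ∈ T, s < t) :
    wedgeBasis S (insert s T) = ExteriorAlgebra.ι S (Pi.single s 1) * wedgeBasis S T := by
  unfold wedgeBasis
  rw [Finset.sort_insert _ (fun t ht => (h t ht).le) (fun hs => lt_irrefl _ (h s hs))]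
  simp

theorem ι_mul_wedgeBasis (s : Fin n) (T : Finset (Fin n)) :
    ExteriorAlgebra.ι S (Pi.single s 1) * wedgeBasis S T =
      if s ∈ T then 0 else wedgeSign s T • wedgeBasis S (insert s T) := by
  induction T using Finset.induction_on_min with
  | empty => simp [wedgeSign, wedgeBasis]
  | insert a T ha ih =>
    have haT : a ∉ T := fun h => lt_irrefl _ (ha a h)
    rcases lt_trichotomy s a with h | rfl | h
    · have hs : ∀ t ∈ insert a T, s < t := by
        intro t ht
        rcases Finset.mem_insert.1 ht with rfl | ht
        · exact h
        · exact h.trans (ha t ht)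
      have hf : (insert a T).filter (· < s) = ∅ :=
        Finset.filter_eq_empty_iff.2 fun t ht => (hs t ht).not_gt
      rw [if_neg (fun hm => lt_irrefl _ (hs s hm)), wedgeSign, hf, wedgeBasis_insert hs]
      simp
    · rw [wedgeBasis_insert ha, ← mul_assoc, ExteriorAlgebra.ι_sq_zero, zero_mul,
        if_pos (Finset.mem_insert_self _ _)]
    · have hanti : ExteriorAlgebra.ι S (Pi.single s 1 : Fin n → S) *
          ExteriorAlgebra.ι S (Pi.single a 1) =
          -(ExteriorAlgebra.ι S (Pi.single a 1) * ExteriorAlgebra.ι S (Pi.single s 1)) :=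
        eq_neg_of_add_eq_zero_left (ExteriorAlgebra.ι_add_mul_swap _ _)
      rw [wedgeBasis_insert ha, ← mul_assoc, hanti, neg_mul, mul_assoc, ih,
        wedgeSign_insert haT, if_pos h, Finset.insert_comm]
      by_cases hs : s ∈ T
      · simp [hs]
      · have : ∀ t ∈ insert s T, a < t := by
          intro t ht
          rcases Finset.mem_insert.1 ht with rfl | ht
          · exact h
          · exact ha t ht
        rw [if_neg hs, if_neg (by simp [hs, h.ne']), wedgeBasis_insert this, mul_smul_comm,
          neg_smul]

/-- The element of the exterior algebra with given coordinates. -/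
def ofCoord : (Finset (Fin n) → S) →ₗ[S] ExteriorAlgebra S (Fin n → S) :=
  Fintype.linearCombination S (wedgeBasis S)

theorem ofCoord_apply (z : Finset (Fin n) → S) : ofCoord z = ∑ T, z T • wedgeBasis S T := rfl

theorem ofCoord_single (T : Finset (Fin n)) (r : S) :
    ofCoord (Pi.single T r) = r • wedgeBasis S T := by
  rw [ofCoord, Fintype.linearCombination_apply_single]

theorem coordWedge_single (s : Fin n) (T : Finset (Fin n)) (r : S) :
    coordWedge s (Pi.single T r) =
      if s ∈ T then 0 else wedgeSign s T • (Pi.single (insert s T) r : Finset (Fin n) → S) := by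
  split_ifs with hs
  · ext U
    rw [coordWedge_apply]
    split_ifs with hU
    · rw [Pi.single_eq_of_ne, smul_zero]
      · rfl
      · rintro rfl; simp at hs
    · rfl
  · ext U
    rw [coordWedge_apply, Pi.smul_apply]
    by_cases hU : U = insert s T
    · subst hU
      have := wedgeSign_insert (t := s) hs
      rw [if_neg (lt_irrefl _)] at this
      simp [this, hs]
    · rw [Pi.single_eq_of_ne hU, smul_zero]
      split_ifs with hsU
      · rw [Pi.single_eq_of_ne, smul_zero]
        rintro rfl
        exact hU (Finset.insert_erase hsU).symm
      · rfl

theorem coordContract_single (s : Fin n) (T : Finset (Fin n)) (r : S) :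
    coordContract s (Pi.single T r) =
      if s ∈ T then wedgeSign s T • (Pi.single (T.erase s) r : Finset (Fin n) → S) else 0 := by
  split_ifs with hs
  · ext U
    rw [coordContract_apply, Pi.smul_apply]
    by_cases hU : U = T.erase s
    · subst hU
      have := wedgeSign_erase (t := s) hs
      rw [if_neg (lt_irrefl _)] at this
      simp [this, Finset.insert_erase hs]
    · rw [Pi.single_eq_of_ne hU, smul_zero]
      split_ifs with hsU
      · rfl
      · rw [Pi.single_eq_of_ne, smul_zero]
        rintro rfl
        exact hU (Finset.erase_insert hsU).symm
  · ext U
    rw [coordContract_apply]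
    split_ifs with hU
    · rfl
    · rw [Pi.single_eq_of_ne, smul_zero]
      · rfl
      · rintro rfl; simp at hs

theorem ofCoord_coordWedge (s : Fin n) (z : Finset (Fin n) → S) :
    ofCoord (coordWedge s z) = ExteriorAlgebra.ι S (Pi.single s 1) * ofCoord z := by
  have h : ofCoord.comp (coordWedgeHom s) =
      (LinearMap.mulLeft S (ExteriorAlgebra.ι S (Pi.single s 1 : Fin n → S))).comp ofCoord := by
    refine LinearMap.pi_ext fun T r => ?_
    simp only [LinearMap.comp_apply, LinearMap.mulLeft_apply, coordWedgeHom_apply, ofCoord_single,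
      coordWedge_single, mul_smul_comm, ι_mul_wedgeBasis]
    split_ifs with hs
    · simp
    · rw [map_zsmul, ofCoord_single, smul_comm]
  exact LinearMap.congr_fun h z

theorem ofCoord_coord (a : ExteriorAlgebra S (Fin n → S)) : ofCoord (coord a) = a := by
  induction a using exteriorAlgebra_left_induction with
  | one => rw [coord_one, ofCoord_single, wedgeBasis_empty, one_smul]
  | smul r x hx => rw [map_smul, map_smul, hx]
  | add x y hx hy => rw [map_add, map_add, hx, hy]
  | ι_mul a i ha => rw [coord_ι_single_mul, ofCoord_coordWedge, ha]

/-- The sign is left as an unspecified unit, since only nonvanishing of products matters later. -/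
theorem coord_wedgeBasis_mul (L T : Finset (Fin n)) (h : Disjoint L T)
    (a : ExteriorAlgebra S (Fin n → S)) (r : S) (ha : coord a = Pi.single T r) :
    ∃ ε : ℤˣ, coord (wedgeBasis S L * a) = (ε : ℤ) • Pi.single (L ∪ T) r := by
  induction L using Finset.induction_on_min with
  | empty => exact ⟨1, by simp [wedgeBasis_empty, ha]⟩
  | insert s L hs ih =>
    obtain ⟨ε, hε⟩ := ih (h.mono_left (Finset.subset_insert _ _))
    have hsL : s ∉ L := fun h => lt_irrefl _ (hs s h)
    have hsT : s ∉ T := Finset.disjoint_left.1 h (Finset.mem_insert_self _ _)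
    refine ⟨ε * (-1) ^ ((L ∪ T).filter (· < s)).card, ?_⟩
    rw [wedgeBasis_insert hs, mul_assoc, coord_ι_single_mul, hε, map_zsmul,
      coordWedge_single, if_neg (by simp [hsL, hsT]), Finset.insert_union, smul_smul]
    simp [wedgeSign]

theorem coord_wedgeBasis (L : Finset (Fin n)) : coord (wedgeBasis S L) = Pi.single L 1 := by
  induction L using Finset.induction_on_min with
  | empty => rw [wedgeBasis_empty, coord_one]
  | insert s L hs ih =>
    have hsL : s ∉ L := fun h => lt_irrefl _ (hs s h)
    have hf : L.filter (· < s) = ∅ := Finset.filter_eq_empty_iff.2 fun t ht => (hs t ht).not_gt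
    rw [wedgeBasis_insert hs, coord_ι_single_mul, ih, coordWedge_single, if_neg hsL, wedgeSign,
      hf]
    simp

/-- With `ofCoord_coord` this makes the `e_T` a basis of the exterior algebra, and lets questions
about Koszul homology be settled on coordinates. -/
theorem coord_ofCoord (z : Finset (Fin n) → S) : coord (ofCoord z) = z := by
  rw [ofCoord_apply, map_sum]
  simp only [map_smul, coord_wedgeBasis]
  ext T
  simp [Finset.sum_apply, Pi.single_apply]

theorem wedgeBasis_mem_exteriorPower (L : Finset (Fin n)) :
    wedgeBasis S L ∈ ⋀[S]^(L.card) (Fin n → S) := by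
  induction L using Finset.induction_on_min with
  | empty =>
    rw [wedgeBasis_empty, Finset.card_empty, ExteriorAlgebra.exteriorPower, pow_zero]
    exact Submodule.mem_one.2 ⟨1, map_one _⟩
  | insert s L hs ih =>
    rw [wedgeBasis_insert hs, Finset.card_insert_of_notMem fun h => lt_irrefl _ (hs s h),
      ExteriorAlgebra.exteriorPower, pow_succ']
    exact Submodule.mul_mem_mul ⟨_, rfl⟩ ih

theorem list_prod_mem_exteriorPower {j : ℕ} (z : Fin j → ExteriorAlgebra S (Fin n → S))
    (k : Fin j → ℕ) (h : ∀ a, z a ∈ ⋀[S]^(k a) (Fin n → S)) :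
    (List.ofFn z).prod ∈ ⋀[S]^(∑ a, k a) (Fin n → S) := by
  induction j with
  | zero =>
    simp only [List.ofFn_zero, List.prod_nil, Finset.univ_eq_empty, Finset.sum_empty]
    rw [ExteriorAlgebra.exteriorPower, pow_zero]
    exact Submodule.mem_one.2 ⟨1, map_one _⟩
  | succ j ih =>
    rw [List.ofFn_succ, List.prod_cons, Fin.sum_univ_succ, ExteriorAlgebra.exteriorPower, pow_add]
    exact Submodule.mul_mem_mul (h 0) (ih _ _ fun a => h a.succ)

end ExteriorCoordinates

/-! ### Koszul homology classes in coordinates. -/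

section KoszulCoordinates

variable {K : Type*} [Field K] {n : ℕ} (I : Ideal (MvPolynomial (Fin n) K))

theorem coord_koszulD (a : KoszulAlgebra I) : coord (koszulD I a) = coordD K (coord a) := by
  rw [koszulD, coord_contractLeft, coordD_def]
  refine Finset.sum_congr rfl fun s _ => ?_
  rw [Fintype.linearCombination_apply_single, one_smul]
  rfl

theorem homologyClass_eq_zero_iff (z : koszulCycles I) :
    homologyClass I z = 0 ↔ ∃ y, coordD K y = coord (z : KoszulAlgebra I) := by
  rw [homologyClass, Ideal.Quotient.eq_zero_iff_mem]
  constructor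
  · rintro ⟨w, hw⟩
    exact ⟨coord w, by rw [← coord_koszulD, hw]⟩
  · rintro ⟨y, hy⟩
    refine ⟨ofCoord y, ?_⟩
    rw [← ofCoord_coord (koszulD I _), coord_koszulD, coord_ofCoord, hy, ofCoord_coord]

theorem prod_homologyClass {j : ℕ} (z : Fin j → koszulCycles I) :
    (List.ofFn fun a => homologyClass I (z a)).prod = homologyClass I (List.ofFn z).prod := by
  unfold homologyClass
  rw [map_list_prod, List.map_ofFn]
  rfl

theorem coordD_coord_cycle (z : koszulCycles I) :
    coordD K (coord (z : KoszulAlgebra I)) = 0 := by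
  rw [← coord_koszulD, (mem_koszulCycles I).1 z.2, map_zero]

end KoszulCoordinates

/-! ### Adding one monomial to a monomial ideal: projective dimension and degrees of Koszul
homology. -/

section MonomialIdeals

universe u

variable (K : Type u) [Field K] {n : ℕ}

/-- The monomial ideal whose monomials are those with exponents in an upper set. -/
def monomialIdeal (U : UpperSet (Fin n →₀ ℕ)) : Ideal (MvPolynomial (Fin n) K) where
  carrier := {f | ∀ m, coeff m f ≠ 0 → m ∈ U}
  zero_mem' := by simp
  add_mem' {a b} ha hb m hm := by
    by_cases h : coeff m a = 0
    · exact hb m fun h' => hm (by rw [coeff_add, h, h', add_zero])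
    · exact ha m h
  smul_mem' g f hf m hm := by
    rw [smul_eq_mul, coeff_mul] at hm
    obtain ⟨⟨a, b⟩, hab, hne⟩ := Finset.exists_ne_zero_of_sum_ne_zero hm
    rw [← Finset.HasAntidiagonal.mem_antidiagonal.1 hab]
    exact U.upper (le_add_self) (hf b fun h => hne (by simp [h]))

variable {K} in
theorem mem_monomialIdeal {U : UpperSet (Fin n →₀ ℕ)} {f : MvPolynomial (Fin n) K} :
    f ∈ monomialIdeal K U ↔ ∀ m, coeff m f ≠ 0 → m ∈ U := Iff.rfl

theorem monomial_mem_monomialIdeal {U : UpperSet (Fin n →₀ ℕ)} {m : Fin n →₀ ℕ} :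
    monomial m (1 : K) ∈ monomialIdeal K U ↔ m ∈ U := by
  rw [mem_monomialIdeal]
  constructor
  · exact fun h => h m (by simp)
  · intro h m' hm'
    rw [coeff_monomial] at hm'
    split_ifs at hm' with hh
    · rwa [← hh]
    · exact absurd rfl hm'

/-- `U` is the upper set of `J + (x_v x^c)` and `Q` that of the colon ideal
`J : x_v x^c = J : x^c`. -/
structure IsMonomialStep (U J Q : UpperSet (Fin n →₀ ℕ)) (v : Fin n) (c : Fin n →₀ ℕ) : Prop where
  mem_iff : ∀ m, m ∈ U ↔ m ∈ J ∨ Finsupp.single v 1 + c ≤ m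
  mem_colon_iff : ∀ m, m ∈ Q ↔ Finsupp.single v 1 + c + m ∈ J
  colon_stable : ∀ m ∈ Q, c + m ∈ J

theorem monomial_mul_mem_monomialIdeal {J Q : UpperSet (Fin n →₀ ℕ)} {e : Fin n →₀ ℕ}
    (h : ∀ m ∈ Q, e + m ∈ J) {f : MvPolynomial (Fin n) K} (hf : f ∈ monomialIdeal K Q) :
    monomial e 1 * f ∈ monomialIdeal K J := by
  intro m hm
  rw [coeff_monomial_mul'] at hm
  split_ifs at hm with hle
  · have := h _ (hf (m - e) (by simpa using hm))
    rwa [add_tsub_cancel_of_le hle] at this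
  · exact absurd rfl hm

namespace IsMonomialStep

variable {K} {U J Q : UpperSet (Fin n →₀ ℕ)} {v : Fin n} {c : Fin n →₀ ℕ}
  (h : IsMonomialStep U J Q v c)

include h

theorem le : monomialIdeal K J ≤ monomialIdeal K U :=
  fun _ hf m hm => (h.mem_iff m).2 (Or.inl (hf m hm))

theorem mem_colon {f : MvPolynomial (Fin n) K} :
    f ∈ monomialIdeal K Q ↔
      monomial (Finsupp.single v 1 + c) 1 * f ∈ monomialIdeal K J := by
  refine ⟨monomial_mul_mem_monomialIdeal K fun m hm => (h.mem_colon_iff m).1 hm, fun hf m hm => ?_⟩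
  rw [h.mem_colon_iff]
  exact hf _ (by rw [coeff_monomial_mul]; simpa using hm)

theorem mul_mem {f : MvPolynomial (Fin n) K} (hf : f ∈ monomialIdeal K Q) :
    monomial c 1 * f ∈ monomialIdeal K J :=
  monomial_mul_mem_monomialIdeal K h.colon_stable hf

theorem monomial_mem : monomial (Finsupp.single v 1 + c) (1 : K) ∈ monomialIdeal K U :=
  (monomial_mem_monomialIdeal K).2 ((h.mem_iff _).2 (Or.inr le_rfl))

theorem modMonomial_mem {f : MvPolynomial (Fin n) K} (hf : f ∈ monomialIdeal K U) :
    f.modMonomial (Finsupp.single v 1 + c) ∈ monomialIdeal K J := by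
  intro m hm
  by_cases hle : Finsupp.single v 1 + c ≤ m
  · exact absurd (coeff_modMonomial_of_le f hle) hm
  · rw [coeff_modMonomial_of_not_le f hle] at hm
    exact ((h.mem_iff m).1 (hf m hm)).resolve_right hle

-- The sequence `0 → R/Q → R/J → R/U → 0`, whose left map is multiplication by `x_v x^c`, is exact:
-- division with remainder by this monomial sends an element of the ideal of `U` to a quotient and a
-- remainder in the ideal of `J`.
open CategoryTheory in
theorem hasProjectiveDimensionLT {p : ℕ}
    (hJ : HasProjectiveDimensionLT (ModuleCat.of (MvPolynomial (Fin n) K)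
      (MvPolynomial (Fin n) K ⧸ monomialIdeal K J)) (p + 1))
    (hQ : HasProjectiveDimensionLT (ModuleCat.of (MvPolynomial (Fin n) K)
      (MvPolynomial (Fin n) K ⧸ monomialIdeal K Q)) p) :
    HasProjectiveDimensionLT (ModuleCat.of (MvPolynomial (Fin n) K)
      (MvPolynomial (Fin n) K ⧸ monomialIdeal K U)) (p + 1) := by
  let e : MvPolynomial (Fin n) K := monomial (Finsupp.single v 1 + c) 1
  let f : (MvPolynomial (Fin n) K ⧸ monomialIdeal K Q) →ₗ[MvPolynomial (Fin n) K]
      (MvPolynomial (Fin n) K ⧸ monomialIdeal K J) :=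
    Submodule.mapQ _ _ (LinearMap.lsmul (MvPolynomial (Fin n) K) (MvPolynomial (Fin n) K) e)
      fun x hx => h.mem_colon.1 hx
  let g : (MvPolynomial (Fin n) K ⧸ monomialIdeal K J) →ₗ[MvPolynomial (Fin n) K]
      (MvPolynomial (Fin n) K ⧸ monomialIdeal K U) :=
    Submodule.mapQ _ _ LinearMap.id fun x hx => h.le hx
  have hfg : g.comp f = 0 := by
    apply Submodule.linearMap_qext
    ext1
    exact (Submodule.Quotient.mk_eq_zero _).2 (Ideal.mul_mem_right _ _ h.monomial_mem)
  have hf : Function.Injective f := by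
    rw [← LinearMap.ker_eq_bot, LinearMap.ker_eq_bot']
    intro x hx
    obtain ⟨x, rfl⟩ := Submodule.Quotient.mk_surjective _ x
    exact (Submodule.Quotient.mk_eq_zero _).2
      (h.mem_colon.2 ((Submodule.Quotient.mk_eq_zero _).1 hx))
  have hg : Function.Surjective g := by
    intro x
    obtain ⟨x, rfl⟩ := Submodule.Quotient.mk_surjective _ x
    exact ⟨Submodule.Quotient.mk x, rfl⟩
  let S : ShortComplex (ModuleCat (MvPolynomial (Fin n) K)) :=
    ShortComplex.mk (ModuleCat.ofHom f) (ModuleCat.ofHom g)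
      (by rw [← ModuleCat.ofHom_comp, hfg]; rfl)
  have hS : S.ShortExact :=
    { exact := (ShortComplex.moduleCat_exact_iff S).2 fun x hx => by
        obtain ⟨x, rfl⟩ := Submodule.Quotient.mk_surjective _ x
        have hx' : x ∈ monomialIdeal K U := (Submodule.Quotient.mk_eq_zero _).1 hx
        refine ⟨Submodule.Quotient.mk (x.divMonomial (Finsupp.single v 1 + c)),
          (Submodule.Quotient.eq _).2 ?_⟩
        rw [← neg_mem_iff, neg_sub]
        have := divMonomial_add_modMonomial x (Finsupp.single v 1 + c)
        nth_rw 1 [← this]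
        simpa [e] using h.modMonomial_mem hx'
      mono_f := (ModuleCat.mono_iff_injective _).2 hf
      epi_g := (ModuleCat.epi_iff_surjective _).2 hg }
  exact hS.hasProjectiveDimensionLT_X₃ p hQ hJ

end IsMonomialStep

/-- The Koszul homology of `R/I`, `I` the monomial ideal of `U`, vanishes in coefficient degrees
above `r`. -/
def KoszulVanishesAbove (U : UpperSet (Fin n →₀ ℕ)) (r : ℕ) : Prop :=
  ∀ z : Finset (Fin n) → MvPolynomial (Fin n) K,
    (∀ T m, coeff m (z T) ≠ 0 → r < m.degree) →
    (∀ T, coordD K z T ∈ monomialIdeal K U) →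
    ∃ y, ∀ T, (z - coordD K y : Finset (Fin n) → MvPolynomial (Fin n) K) T ∈ monomialIdeal K U

variable {K}

theorem KoszulVanishesAbove.mono {U : UpperSet (Fin n →₀ ℕ)} {r r' : ℕ}
    (h : KoszulVanishesAbove K U r) (hr : r ≤ r') : KoszulVanishesAbove K U r' :=
  fun z hz hd => h z (fun T m hm => hr.trans_lt (hz T m hm)) hd

/-- The differential raises coefficient degrees by exactly one. -/
theorem exists_coeff_ne_zero_of_coordD {z : Finset (Fin n) → MvPolynomial (Fin n) K}
    {T : Finset (Fin n)} {m : Fin n →₀ ℕ} (hm : coeff m (coordD K z T) ≠ 0) :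
    ∃ T' m', coeff m' (z T') ≠ 0 ∧ m.degree = m'.degree + 1 := by
  rw [coordD_apply, coeff_sum] at hm
  obtain ⟨s, -, hs⟩ := Finset.exists_ne_zero_of_sum_ne_zero hm
  rw [smul_eq_mul, coeff_X_mul'] at hs
  split_ifs at hs with h1 h2
  · simp at hs
  · rw [coeff_smul] at hs
    refine ⟨_, _, right_ne_zero_of_smul hs, ?_⟩
    have h4 : m s ≠ 0 := by simpa using h1
    have h5 : m - Finsupp.single s 1 + Finsupp.single s 1 = m :=
      tsub_add_cancel_of_le (by simpa [Finsupp.single_le_iff, Nat.one_le_iff_ne_zero] using h4)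
    conv_lhs => rw [← h5]
    rw [map_add, Finsupp.degree_single]
  · exact absurd rfl hs

/-- The part of `f` of degree less than `r`. -/
def lowPart (r : ℕ) (f : MvPolynomial (Fin n) K) : MvPolynomial (Fin n) K :=
  ∑ i ∈ Finset.range r, homogeneousComponent i f

theorem coeff_lowPart (r : ℕ) (f : MvPolynomial (Fin n) K) (m : Fin n →₀ ℕ) :
    coeff m (lowPart r f) = if m.degree < r then coeff m f else 0 := by
  simp [lowPart, coeff_sum, coeff_homogeneousComponent]

/-- Primitives of elements of large degree modulo a monomial ideal can be chosen of large
degree. -/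
theorem exists_primitive_of_degree {U : UpperSet (Fin n →₀ ℕ)} {r : ℕ}
    {u y : Finset (Fin n) → MvPolynomial (Fin n) K}
    (hu : ∀ T m, coeff m (u T) ≠ 0 → r < m.degree)
    (hy : ∀ T, (u - coordD K y : Finset (Fin n) → MvPolynomial (Fin n) K) T ∈ monomialIdeal K U) :
    ∃ y', (∀ T m, coeff m (y' T) ≠ 0 → r ≤ m.degree) ∧
      ∀ T, (u - coordD K y' : Finset (Fin n) → MvPolynomial (Fin n) K) T ∈ monomialIdeal K U := by
  let l : Finset (Fin n) → MvPolynomial (Fin n) K := fun T => lowPart r (y T)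
  have hl : ∀ T m, coeff m (l T) ≠ 0 → m.degree < r := fun T m hm => by
    by_contra h
    exact hm (by simp only [l, coeff_lowPart, if_neg h])
  have hyl : ∀ T m, coeff m ((y - l : Finset (Fin n) → MvPolynomial (Fin n) K) T) ≠ 0 →
      r ≤ m.degree := fun T m hm => by
    by_contra h
    refine hm ?_
    simp only [Pi.sub_apply, l, coeff_sub, coeff_lowPart, if_pos (not_le.1 h), sub_self]
  refine ⟨y - l, hyl, fun T m hm => ?_⟩
  by_cases hr : r < m.degree
  · apply hy T m
    have h0 : coeff m (coordD K l T) = 0 := by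
      by_contra h
      obtain ⟨T', m', h1, h2⟩ := exists_coeff_ne_zero_of_coordD h
      have := hl T' m' h1
      omega
    rw [map_sub] at hm
    simpa [h0] using hm
  · exfalso
    have h1 : coeff m (u T) = 0 := by_contra fun h => hr (hu T m h)
    have h2 : coeff m (coordD K (y - l) T) = 0 := by
      by_contra h
      obtain ⟨T', m', h1, h2⟩ := exists_coeff_ne_zero_of_coordD h
      have := hyl T' m' h1
      omega
    exact hm (by rw [Pi.sub_apply, coeff_sub, h1, h2, sub_zero])

/-- A chase in the long exact homology sequence. Dividing `d z` by `x_v x^c` gives the image `u` of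
`z` under the connecting map, a cycle modulo `Q`. Once `u` is a boundary modulo `Q`, `z` can be
corrected by a multiple of `x_v x^c` to a cycle modulo `J`. -/
theorem IsMonomialStep.koszulVanishesAbove {U J Q : UpperSet (Fin n →₀ ℕ)} {v : Fin n}
    {c : Fin n →₀ ℕ} (h : IsMonomialStep U J Q v c) {r : ℕ}
    (hJ : KoszulVanishesAbove K J (r + c.degree)) (hQ : KoszulVanishesAbove K Q r) :
    KoszulVanishesAbove K U (r + c.degree) := by
  intro z hz hd
  set e : Fin n →₀ ℕ := Finsupp.single v 1 + c with he
  let u : Finset (Fin n) → MvPolynomial (Fin n) K := fun T => (coordD K z T).divMonomial e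
  let q : Finset (Fin n) → MvPolynomial (Fin n) K := fun T => (coordD K z T).modMonomial e
  have huq : coordD K z = monomial e (1 : K) • u + q := by
    ext1 T
    exact (divMonomial_add_modMonomial _ e).symm
  have hq : ∀ T, q T ∈ monomialIdeal K J := fun T => h.modMonomial_mem (hd T)
  have hdu : ∀ T, coordD K u T ∈ monomialIdeal K Q := by
    intro T
    rw [h.mem_colon]
    have h1 : monomial e (1 : K) • coordD K u = -coordD K q := by
      have := coordD_coordD (K := K) z
      rw [huq, map_add, coordD_smul] at this
      exact eq_neg_of_add_eq_zero_left this
    have h2 := congrFun h1 T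
    rw [Pi.smul_apply, smul_eq_mul] at h2
    rw [← he, h2]
    exact neg_mem (coordD_mem _ q hq T)
  have hu : ∀ T m, coeff m (u T) ≠ 0 → r < m.degree := by
    intro T m hm
    obtain ⟨T', m', h1, h2⟩ := exists_coeff_ne_zero_of_coordD (z := z) (T := T) (m := e + m) hm
    have := hz T' m' h1
    rw [he, map_add, map_add, Finsupp.degree_single] at h2
    omega
  obtain ⟨y₀, hy₀⟩ := hQ u hu hdu
  -- The primitive must have coefficients of degree at least `r`: multiplied by `x_v x^c`, of degree
  -- `c.degree + 1`, it then stays above `r + c.degree`, where `hJ` applies.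
  obtain ⟨y, hyr, hy⟩ := exists_primitive_of_degree hu hy₀
  have hdeg : ∀ T m, coeff m ((z - monomial e (1 : K) • y :
      Finset (Fin n) → MvPolynomial (Fin n) K) T) ≠ 0 → r + c.degree < m.degree := by
    intro T m hm
    by_cases h0 : coeff m (z T) = 0
    · rw [Pi.sub_apply, Pi.smul_apply, smul_eq_mul, coeff_sub, h0, zero_sub,
        coeff_monomial_mul'] at hm
      split_ifs at hm with hle
      · have := hyr T (m - e) (by simpa using hm)
        have h5 : m - e + e = m := tsub_add_cancel_of_le hle
        rw [← h5, map_add]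
        nth_rw 2 [he]
        rw [map_add, Finsupp.degree_single]
        omega
      · simp at hm
    · exact hz T m h0
  have hdJ : ∀ T, coordD K (z - monomial e (1 : K) • y) T ∈ monomialIdeal K J := by
    intro T
    have h1 : coordD K (z - monomial e (1 : K) • y) T =
        monomial e 1 * ((u - coordD K y : Finset (Fin n) → MvPolynomial (Fin n) K) T) + q T := by
      rw [map_sub, coordD_smul, huq]
      simp only [Pi.sub_apply, Pi.smul_apply, Pi.add_apply, smul_eq_mul]; ring
    rw [h1]
    exact add_mem (h.mem_colon.1 (hy T)) (hq T)
  obtain ⟨w, hw⟩ := hJ _ hdeg hdJ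
  refine ⟨w, fun T => ?_⟩
  have h1 : (z - coordD K w : Finset (Fin n) → MvPolynomial (Fin n) K) T =
      (z - monomial e (1 : K) • y - coordD K w : Finset (Fin n) → MvPolynomial (Fin n) K) T +
        monomial e 1 * y T := by
    simp only [Pi.sub_apply, Pi.smul_apply, smul_eq_mul]; ring
  rw [h1]
  exact add_mem (h.le (hw T)) (Ideal.mul_mem_right _ _ h.monomial_mem)

theorem koszulVanishesAbove_top : KoszulVanishesAbove K (⊤ : UpperSet (Fin n →₀ ℕ)) 0 := by
  intro z hz hd
  have h0 : ∀ f ∈ monomialIdeal K (⊤ : UpperSet (Fin n →₀ ℕ)), f = 0 := by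
    intro f hf
    ext m
    exact by_contra fun h => hf m h
  obtain ⟨y, hy⟩ := exists_coordD_eq (K := K) (z := z) (by ext1 T; exact h0 _ (hd T))
    (by_contra fun h => by simpa using hz ∅ 0 h)
  refine ⟨y, fun T => ?_⟩
  rw [hy, sub_self]
  exact zero_mem _

theorem monomialIdeal_top : monomialIdeal K (⊤ : UpperSet (Fin n →₀ ℕ)) = ⊥ := by
  refine (Submodule.eq_bot_iff _).2 fun f hf => ?_
  ext m
  exact by_contra fun h => hf m h

open CategoryTheory in
theorem hasProjectiveDimensionLT_top :
    HasProjectiveDimensionLT (ModuleCat.of (MvPolynomial (Fin n) K)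
      (MvPolynomial (Fin n) K ⧸ monomialIdeal K (⊤ : UpperSet (Fin n →₀ ℕ)))) 1 := by
  apply projective_iff_hasProjectiveDimensionLT_one.1
  apply (IsProjective.iff_projective _).1
  rw [monomialIdeal_top]
  exact Module.Projective.of_equiv (Submodule.quotEquivOfEqBot _ rfl).symm

end MonomialIdeals

/-! ### Graded maps between free modules and homogeneous lifts. -/

section GradedMaps

variable {K : Type*} [Field K] {n : ℕ} {A B C : Type*}

/-- The nonzero coefficients of the vector `x` in a free module with basis elements of degrees
`deg` lie in total degrees satisfying `P`. -/
def DegreesIn (deg : A → ℕ) (P : ℕ → Prop) (x : A → MvPolynomial (Fin n) K) : Prop :=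
  ∀ p m, coeff m (x p) ≠ 0 → P (m.degree + deg p)

/-- A linear map of degree `a` between graded free modules. -/
def IsGradedMap [DecidableEq A] (degA : A → ℕ) (degB : B → ℕ) (a : ℕ)
    (f : (A → MvPolynomial (Fin n) K) →ₗ[MvPolynomial (Fin n) K] (B → MvPolynomial (Fin n) K)) :
    Prop :=
  ∀ q, DegreesIn degB (· = degA q + a) (f (Pi.single q 1))

variable {degA : A → ℕ} {degB : B → ℕ} {degC : C → ℕ} {a : ℕ}

theorem DegreesIn.eq_of_sub {k : ℕ} {x y : A → MvPolynomial (Fin n) K}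
    (hx : DegreesIn degA (· = k) x) (hy : DegreesIn degA (· = k) y)
    (hxy : DegreesIn degA (· ≠ k) (x - y)) : x = y := by
  refine _root_.sub_eq_zero.1 ?_
  ext p m
  by_contra h
  refine hxy p m h ?_
  by_cases h1 : coeff m (x p) = 0
  · refine hy p m fun h2 => h ?_
    simp [h1, h2]
  · exact hx p m h1

theorem IsGradedMap.degreesIn [Fintype A] [DecidableEq A]
    {f : (A → MvPolynomial (Fin n) K) →ₗ[MvPolynomial (Fin n) K] (B → MvPolynomial (Fin n) K)}
    (hf : IsGradedMap degA degB a f) {P : ℕ → Prop} {x : A → MvPolynomial (Fin n) K}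
    (hx : DegreesIn degA P x) : DegreesIn degB (fun k => ∃ l, P l ∧ k = l + a) (f x) := by
  intro p m hm
  rw [pi_eq_sum_univ' x, map_sum, Finset.sum_apply, coeff_sum] at hm
  obtain ⟨q, -, hq⟩ := Finset.exists_ne_zero_of_sum_ne_zero hm
  rw [map_smul, Pi.smul_apply, smul_eq_mul, coeff_mul] at hq
  obtain ⟨⟨m₁, m₂⟩, hmm, hne⟩ := Finset.exists_ne_zero_of_sum_ne_zero hq
  have h1 := hx q m₁ (left_ne_zero_of_mul hne)
  have h2 : m₂.degree + degB p = degA q + a := hf q p m₂ (right_ne_zero_of_mul hne)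
  refine ⟨_, h1, ?_⟩
  rw [← Finset.HasAntidiagonal.mem_antidiagonal.1 hmm, map_add]
  dsimp only
  omega

/-- The component of degree `k` of a vector in a graded free module. -/
def gradedComponent (deg : A → ℕ) (k : ℕ) (x : A → MvPolynomial (Fin n) K) :
    A → MvPolynomial (Fin n) K :=
  fun p => if deg p ≤ k then homogeneousComponent (k - deg p) (x p) else 0

theorem coeff_gradedComponent (k : ℕ) (x : A → MvPolynomial (Fin n) K) (p : A) (m : Fin n →₀ ℕ) :
    coeff m (gradedComponent degA k x p) =
      if m.degree + degA p = k then coeff m (x p) else 0 := by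
  unfold gradedComponent
  split_ifs with h1 h2 h2
  · rw [coeff_homogeneousComponent, if_pos (by omega)]
  · rw [coeff_homogeneousComponent, if_neg (by omega)]
  · omega
  · simp

/-- A graded map respects homogeneous components, so the component of degree `k` of any preimage is
again a preimage. -/
theorem IsGradedMap.exists_degreesIn_preimage [Fintype A] [DecidableEq A]
    {f : (A → MvPolynomial (Fin n) K) →ₗ[MvPolynomial (Fin n) K] (B → MvPolynomial (Fin n) K)}
    (hf : IsGradedMap degA degB a f) {k : ℕ} {x : A → MvPolynomial (Fin n) K}
    (hx : DegreesIn degB (· = k + a) (f x)) :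
    ∃ y, DegreesIn degA (· = k) y ∧ f y = f x := by
  have hy : DegreesIn degA (· = k) (gradedComponent degA k x) := by
    intro p m hm
    rw [coeff_gradedComponent] at hm
    exact by_contra fun h => hm (if_neg h)
  refine ⟨_, hy, (DegreesIn.eq_of_sub (degA := degB) (k := k + a) hx ?_ ?_).symm⟩
  · intro p m hm
    obtain ⟨l, rfl, h⟩ := hf.degreesIn hy p m hm
    exact h
  · rw [← map_sub]
    have h : DegreesIn degA (· ≠ k) (x - gradedComponent degA k x) := by
      intro p m hm h
      refine hm ?_
      rw [Pi.sub_apply, coeff_sub, coeff_gradedComponent, if_pos h, sub_self]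
    intro p m hm
    obtain ⟨l, hl, h⟩ := hf.degreesIn h p m hm
    omega

theorem IsGradedMap.exists_lift [Fintype A] [DecidableEq A] [Fintype B] [DecidableEq B]
    {f : (B → MvPolynomial (Fin n) K) →ₗ[MvPolynomial (Fin n) K] (C → MvPolynomial (Fin n) K)}
    {g : (A → MvPolynomial (Fin n) K) →ₗ[MvPolynomial (Fin n) K] (C → MvPolynomial (Fin n) K)}
    (hf : IsGradedMap degB degC 0 f) (hg : IsGradedMap degA degC a g)
    (hgf : ∀ x, ∃ y, f y = g x) :
    ∃ φ : (A → MvPolynomial (Fin n) K) →ₗ[MvPolynomial (Fin n) K] (B → MvPolynomial (Fin n) K),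
      IsGradedMap degA degB a φ ∧ ∀ x, f (φ x) = g x := by
  have H : ∀ q, ∃ y, DegreesIn degB (· = degA q + a) y ∧ f y = g (Pi.single q 1) := by
    intro q
    obtain ⟨x, hx⟩ := hgf (Pi.single q 1)
    rw [← hx]
    refine hf.exists_degreesIn_preimage ?_
    rw [hx]
    exact hg q
  choose w hw hfw using H
  refine ⟨Fintype.linearCombination _ w, fun q => ?_, fun x => ?_⟩
  · rw [Fintype.linearCombination_apply_single, one_smul]
    exact hw q
  · rw [Fintype.linearCombination_apply, map_sum]
    conv_rhs => rw [pi_eq_sum_univ' x, map_sum]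
    exact Finset.sum_congr rfl fun q _ => by rw [map_smul, map_smul, hfw]

end GradedMaps

/-! ### Minimal graded resolutions and the comparison theorem. -/

section Resolutions

variable {K : Type*} [Field K] {n : ℕ}

/-- A minimal graded free resolution of `R/I` that starts with `R` in degree `0`, with bases
indexed by arbitrary finite types. -/
structure CyclicResolution (I : Ideal (MvPolynomial (Fin n) K)) where
  idx : ℕ → Type
  fintype : ∀ i, Fintype (idx i)
  decEq : ∀ i, DecidableEq (idx i)
  deg : ∀ i, idx i → ℕ
  root : idx 0
  eq_root : ∀ p, p = root
  deg_root : deg 0 root = 0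
  d : ∀ i, (idx (i + 1) → MvPolynomial (Fin n) K) →ₗ[MvPolynomial (Fin n) K]
    (idx i → MvPolynomial (Fin n) K)
  graded : ∀ i, IsGradedMap (deg (i + 1)) (deg i) 0 (d i)
  minimal : ∀ i q p, coeff 0 (d i (Pi.single q 1) p) = 0
  exact_zero : ∀ x, (∃ y, d 0 y = x) ↔ x root ∈ I
  exact_succ : ∀ i x, (∃ y, d (i + 1) y = x) ↔ d i x = 0

attribute [instance] CyclicResolution.fintype CyclicResolution.decEq

namespace CyclicResolution

variable {I J : Ideal (MvPolynomial (Fin n) K)}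

/-- The maximum of the numbers `degree - homological degree` is `r`. -/
def HasReg (F : CyclicResolution I) (r : ℕ) : Prop :=
  (∀ i p, F.deg i p ≤ r + i) ∧ ∃ i p, F.deg i p = r + i

/-- The comparison theorem, lifting multiplication by `x^c` with control of degrees. -/
theorem exists_chainMap (F : CyclicResolution I) (G : CyclicResolution J) (c : Fin n →₀ ℕ)
    (h : ∀ f ∈ I, monomial c 1 * f ∈ J) :
    ∃ φ : ∀ i, (F.idx i → MvPolynomial (Fin n) K) →ₗ[MvPolynomial (Fin n) K]
        (G.idx i → MvPolynomial (Fin n) K),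
      (∀ i, IsGradedMap (F.deg i) (G.deg i) c.degree (φ i)) ∧
      (∀ i x, G.d i (φ (i + 1) x) = φ i (F.d i x)) ∧
      ∀ x, φ 0 x G.root = monomial c 1 * x F.root := by
  -- The recursion carries along that `φ ∘ d` lands in the image of the next differential of `G`,
  -- which is what allows the next lift.
  let S : ℕ → Type _ := fun i =>
    {φ : (F.idx i → MvPolynomial (Fin n) K) →ₗ[MvPolynomial (Fin n) K]
        (G.idx i → MvPolynomial (Fin n) K) //
      IsGradedMap (F.deg i) (G.deg i) c.degree φ ∧ ∀ x, ∃ y, G.d i y = φ (F.d i x)}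
  have step : ∀ i (φ : S i), ∃ ψ : S (i + 1), ∀ x, G.d i (ψ.1 x) = φ.1 (F.d i x) := by
    rintro i ⟨φ, hφ, hd⟩
    have hg : IsGradedMap (F.deg (i + 1)) (G.deg i) c.degree (φ.comp (F.d i)) := by
      intro q p m hm
      obtain ⟨l, hl, h⟩ := hφ.degreesIn (F.graded i q) p m hm
      omega
    obtain ⟨ψ, hψ, hψd⟩ := (G.graded i).exists_lift hg hd
    refine ⟨⟨ψ, hψ, fun x => (G.exact_succ i _).2 ?_⟩, hψd⟩
    rw [hψd, LinearMap.comp_apply, (F.exact_succ i _).1 ⟨x, rfl⟩, map_zero]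
  choose next hnext using step
  let φ₀ : (F.idx 0 → MvPolynomial (Fin n) K) →ₗ[MvPolynomial (Fin n) K]
      (G.idx 0 → MvPolynomial (Fin n) K) :=
    LinearMap.pi fun _ => monomial c (1 : K) • LinearMap.proj F.root
  have hφ₀ : ∀ x p, φ₀ x p = monomial c 1 * x F.root := fun x p => rfl
  let s₀ : S 0 := ⟨φ₀, by
      intro q p m hm
      rw [hφ₀, F.eq_root q, Pi.single_eq_same, mul_one, coeff_monomial] at hm
      have hmc : c = m := by_contra fun h => hm (if_neg h)
      rw [G.eq_root p, F.eq_root q, F.deg_root, G.deg_root, hmc]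
      omega, fun x => (G.exact_zero _).2 (by
        rw [hφ₀]
        exact h _ ((F.exact_zero _).1 ⟨x, rfl⟩))⟩
  let s : ∀ i, S i := fun i => Nat.rec s₀ next i
  exact ⟨fun i => (s i).1, fun i => (s i).2.1, fun i x => hnext i (s i) x, fun x => hφ₀ x _⟩

/-! ### The mapping cone of `x_v` times a comparison map. -/

section Cone

variable {U J Q : UpperSet (Fin n →₀ ℕ)} {v : Fin n} {c : Fin n →₀ ℕ}

/-- The index types of the mapping cone. -/
def coneIdx (F : CyclicResolution (monomialIdeal K J)) (G : CyclicResolution (monomialIdeal K Q)) :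
    ℕ → Type
  | 0 => F.idx 0
  | i + 1 => F.idx (i + 1) ⊕ G.idx i

/-- The degrees of the basis of the mapping cone. -/
def coneDeg (F : CyclicResolution (monomialIdeal K J)) (G : CyclicResolution (monomialIdeal K Q))
    (a : ℕ) : ∀ i, coneIdx F G i → ℕ
  | 0 => F.deg 0
  | i + 1 => Sum.elim (F.deg (i + 1)) fun q => G.deg i q + a + 1

variable (F : CyclicResolution (monomialIdeal K J)) (G : CyclicResolution (monomialIdeal K Q))

instance coneFintype : ∀ i, Fintype (coneIdx F G i)
  | 0 => F.fintype 0
  | i + 1 => inferInstanceAs (Fintype (F.idx (i + 1) ⊕ G.idx i))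

instance coneDecEq : ∀ i, DecidableEq (coneIdx F G i)
  | 0 => F.decEq 0
  | i + 1 => inferInstanceAs (DecidableEq (F.idx (i + 1) ⊕ G.idx i))

variable {F G}
variable (v) (φ : ∀ i, (G.idx i → MvPolynomial (Fin n) K) →ₗ[MvPolynomial (Fin n) K]
  (F.idx i → MvPolynomial (Fin n) K))

/-- The first differential of the mapping cone. -/
def coneDZero : (F.idx 1 ⊕ G.idx 0 → MvPolynomial (Fin n) K) →ₗ[MvPolynomial (Fin n) K]
    (F.idx 0 → MvPolynomial (Fin n) K) :=
  (F.d 0).comp (LinearMap.funLeft _ _ Sum.inl) +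
    (X v : MvPolynomial (Fin n) K) • (φ 0).comp (LinearMap.funLeft _ _ Sum.inr)

/-- The higher differentials of the mapping cone. -/
def coneDSucc (i : ℕ) : (F.idx (i + 2) ⊕ G.idx (i + 1) → MvPolynomial (Fin n) K)
    →ₗ[MvPolynomial (Fin n) K] (F.idx (i + 1) ⊕ G.idx i → MvPolynomial (Fin n) K) :=
  (LinearEquiv.sumArrowLequivProdArrow (F.idx (i + 1)) (G.idx i)
        (MvPolynomial (Fin n) K) (MvPolynomial (Fin n) K)).symm.toLinearMap.comp
      (LinearMap.prod ((F.d (i + 1)).comp (LinearMap.funLeft _ _ Sum.inl) +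
        (X v : MvPolynomial (Fin n) K) • (φ (i + 1)).comp (LinearMap.funLeft _ _ Sum.inr))
      (-(G.d i).comp (LinearMap.funLeft _ _ Sum.inr)))

/-- The differential of the mapping cone. -/
def coneD : ∀ i, (coneIdx F G (i + 1) → MvPolynomial (Fin n) K) →ₗ[MvPolynomial (Fin n) K]
      (coneIdx F G i → MvPolynomial (Fin n) K)
  | 0 => coneDZero v φ
  | i + 1 => coneDSucc v φ i

theorem coneDZero_apply (x : F.idx 1 ⊕ G.idx 0 → MvPolynomial (Fin n) K) :
    coneDZero v φ x = F.d 0 (x ∘ Sum.inl) +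
      (X v : MvPolynomial (Fin n) K) • φ 0 (x ∘ Sum.inr) := rfl

theorem coneDSucc_apply (i : ℕ) (x : F.idx (i + 2) ⊕ G.idx (i + 1) → MvPolynomial (Fin n) K) :
    coneDSucc v φ i x = Sum.elim (F.d (i + 1) (x ∘ Sum.inl) +
      (X v : MvPolynomial (Fin n) K) • φ (i + 1) (x ∘ Sum.inr)) (-G.d i (x ∘ Sum.inr)) := rfl

theorem single_inl_comp_inl {A B S : Type*} [DecidableEq A] [DecidableEq B] [Zero S] (q : A)
    (r : S) : (Pi.single (Sum.inl q) r : A ⊕ B → S) ∘ Sum.inl = Pi.single q r := by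
  ext p; simp [Pi.single_apply]

theorem single_inl_comp_inr {A B S : Type*} [DecidableEq A] [DecidableEq B] [Zero S] (q : A)
    (r : S) : (Pi.single (Sum.inl q) r : A ⊕ B → S) ∘ Sum.inr = 0 := by
  ext p; simp

theorem single_inr_comp_inr {A B S : Type*} [DecidableEq A] [DecidableEq B] [Zero S] (q : B)
    (r : S) : (Pi.single (Sum.inr q) r : A ⊕ B → S) ∘ Sum.inr = Pi.single q r := by
  ext p; simp [Pi.single_apply]

theorem single_inr_comp_inl {A B S : Type*} [DecidableEq A] [DecidableEq B] [Zero S] (q : B)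
    (r : S) : (Pi.single (Sum.inr q) r : A ⊕ B → S) ∘ Sum.inl = 0 := by
  ext p; simp

variable {v φ}

theorem coeff_X_smul_degree {A : Type*} {deg : A → ℕ} {k : ℕ} {x : A → MvPolynomial (Fin n) K}
    (hx : DegreesIn deg (· = k) x) :
    DegreesIn deg (· = k + 1) ((X v : MvPolynomial (Fin n) K) • x) := by
  intro p m hm
  rw [Pi.smul_apply, smul_eq_mul, coeff_X_mul'] at hm
  split_ifs at hm with h1
  · have h2 := hx p _ hm
    have h4 : m v ≠ 0 := by simpa using h1
    have h5 : m - Finsupp.single v 1 + Finsupp.single v 1 = m :=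
      tsub_add_cancel_of_le (by simpa [Finsupp.single_le_iff, Nat.one_le_iff_ne_zero] using h4)
    rw [← h5, map_add, Finsupp.degree_single]
    simp only at h2
    omega
  · exact absurd rfl hm

theorem coneD_exact (h : IsMonomialStep U J Q v c)
    (hφ : ∀ i x, F.d i (φ (i + 1) x) = φ i (G.d i x))
    (hφ₀ : ∀ x, φ 0 x F.root = monomial c 1 * x G.root) :
    (∀ x, (∃ y, coneDZero v φ y = x) ↔ x F.root ∈ monomialIdeal K U) ∧
    (∀ i x, (∃ y, coneD v φ (i + 1) y = x) ↔ coneD v φ i x = 0) := by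
  have hX : (X v : MvPolynomial (Fin n) K) * monomial c 1 =
      monomial (Finsupp.single v 1 + c) 1 := by
    rw [X, monomial_mul, one_mul]
  have hX' : ∀ f : MvPolynomial (Fin n) K, X v * (monomial c 1 * f) =
      monomial (Finsupp.single v 1 + c) 1 * f := fun f => by rw [← mul_assoc, hX]
  -- exactness beyond the first step, once the second component is known to be a boundary
  have key : ∀ i (a : F.idx (i + 1) → MvPolynomial (Fin n) K)
      (b' : G.idx (i + 1) → MvPolynomial (Fin n) K),
      F.d i a + (X v : MvPolynomial (Fin n) K) • φ i (-G.d i b') = 0 →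
      ∃ y, coneDSucc v φ i y = Sum.elim a (-G.d i b') := by
    intro i a b' hab
    have h1 : F.d i (a - (X v : MvPolynomial (Fin n) K) • φ (i + 1) b') = 0 := by
      rw [map_sub, map_smul, hφ, ← hab, map_neg, smul_neg, sub_eq_add_neg]
    obtain ⟨a', ha'⟩ := (F.exact_succ i _).2 h1
    refine ⟨Sum.elim a' b', ?_⟩
    rw [coneDSucc_apply, Sum.elim_comp_inl, Sum.elim_comp_inr, ha', sub_add_cancel]
  have h0 : ∀ i (y : F.idx (i + 2) ⊕ G.idx (i + 1) → MvPolynomial (Fin n) K),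
      F.d i (F.d (i + 1) (y ∘ Sum.inl) + (X v : MvPolynomial (Fin n) K) •
        φ (i + 1) (y ∘ Sum.inr)) +
      (X v : MvPolynomial (Fin n) K) • φ i (-G.d i (y ∘ Sum.inr)) = 0 := by
    intro i y
    rw [map_add, (F.exact_succ i _).1 ⟨_, rfl⟩, map_smul, hφ, map_neg, smul_neg, zero_add,
      add_neg_cancel]
  have backZero : ∀ y, coneDZero v φ (coneDSucc v φ 0 y) = 0 := by
    intro y
    rw [coneDSucc_apply, coneDZero_apply, Sum.elim_comp_inl, Sum.elim_comp_inr]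
    exact h0 0 y
  have backSucc : ∀ i y, coneDSucc v φ i (coneDSucc v φ (i + 1) y) = 0 := by
    intro i y
    rw [coneDSucc_apply v φ (i + 1), coneDSucc_apply v φ i, Sum.elim_comp_inl, Sum.elim_comp_inr,
      h0, map_neg, (G.exact_succ i _).1 ⟨_, rfl⟩]
    ext p
    rcases p with p | p <;> simp
  refine ⟨fun x => ⟨?_, fun hx => ?_⟩, fun i x => ⟨?_, fun hx => ?_⟩⟩
  · rintro ⟨y, rfl⟩
    rw [coneDZero_apply, Pi.add_apply, Pi.smul_apply, smul_eq_mul, hφ₀, hX']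
    exact add_mem (h.le ((F.exact_zero _).1 ⟨_, rfl⟩)) (Ideal.mul_mem_right _ _ h.monomial_mem)
  -- Division with remainder by `x_v x^c`: the remainder lies in the ideal of `J` and comes from
  -- `F`; the quotient becomes the component in `G`.
  · obtain ⟨a, ha⟩ := (F.exact_zero
      (fun _ => (x F.root).modMonomial (Finsupp.single v 1 + c))).2 (h.modMonomial_mem hx)
    refine ⟨Sum.elim a fun _ => (x F.root).divMonomial (Finsupp.single v 1 + c), ?_⟩
    funext p
    rw [F.eq_root p, coneDZero_apply, Sum.elim_comp_inl, Sum.elim_comp_inr, ha, Pi.add_apply,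
      Pi.smul_apply, smul_eq_mul, hφ₀, hX', add_comm]
    exact divMonomial_add_modMonomial _ _
  · rintro ⟨y, rfl⟩
    rcases i with _ | i
    · exact backZero y
    · exact backSucc i y
  · change F.idx (i + 1) ⊕ G.idx i → MvPolynomial (Fin n) K at x
    -- In the lowest degree, being a cycle says that `x_v x^c` times the second component lies in
    -- the ideal of `J`, so that component lies in the colon ideal. In higher degrees it is a cycle
    -- of `G`.
    have hb : ∃ b', G.d i b' = -(x ∘ Sum.inr) := by
      rcases i with _ | i
      · rw [G.exact_zero, Pi.neg_apply, neg_mem_iff, h.mem_colon]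
        have h1 : F.d 0 (x ∘ Sum.inl) F.root + X v * (φ 0 (x ∘ Sum.inr) F.root) = 0 :=
          congrFun hx F.root
        rw [hφ₀, hX'] at h1
        rw [eq_neg_of_add_eq_zero_right h1]
        exact neg_mem ((F.exact_zero _).1 ⟨_, rfl⟩)
      · rw [G.exact_succ]
        funext p
        rw [map_neg]
        exact congrFun hx (Sum.inr p)
    obtain ⟨b', hb'⟩ := hb
    have hxe : x = Sum.elim (x ∘ Sum.inl) (-G.d i b') := by
      rw [hb', neg_neg]; exact (Sum.elim_comp_inl_inr x).symm
    rw [hxe]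
    refine key i (x ∘ Sum.inl) b' ?_
    rw [hb', neg_neg]
    rcases i with _ | i
    · exact hx
    · funext p
      exact congrFun hx (Sum.inl p)

/-- Because `x^c` already maps `Q` into `J`, the comparison map for `x_v x^c` can be taken divisible
by `x_v`. No entry of the cone is then a unit, so the cone is minimal and the regularity is an exact
maximum. A basis element of `G` gains `c.degree + 1` in degree and one in homological degree. -/
theorem exists_cone (F : CyclicResolution (monomialIdeal K J))
    (G : CyclicResolution (monomialIdeal K Q)) (h : IsMonomialStep U J Q v c) {r₁ r₂ : ℕ}
    (hF : F.HasReg r₁) (hG : G.HasReg r₂) :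
    ∃ E : CyclicResolution (monomialIdeal K U), E.HasReg (max r₁ (r₂ + c.degree)) := by
  obtain ⟨φ, hφg, hφ, hφ₀⟩ := G.exists_chainMap F c fun f hf => h.mul_mem hf
  have hXφ : ∀ i q, DegreesIn (F.deg i) (· = G.deg i q + c.degree + 1)
      ((X v : MvPolynomial (Fin n) K) • φ i (Pi.single q 1)) :=
    fun i q => coeff_X_smul_degree (hφg i q)
  have hXc : ∀ f : MvPolynomial (Fin n) K, coeff 0 (X v * f) = 0 := fun f => by
    simp [coeff_X_mul']
  refine ⟨{ idx := coneIdx F G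
            fintype := coneFintype F G
            decEq := coneDecEq F G
            deg := coneDeg F G c.degree
            root := F.root
            eq_root := F.eq_root
            deg_root := F.deg_root
            d := coneD v φ
            graded := ?_
            minimal := ?_
            exact_zero := (coneD_exact h hφ hφ₀).1
            exact_succ := (coneD_exact h hφ hφ₀).2 }, ?_, ?_⟩
  · rintro (_ | i) (q | q) p m hm
    · change coeff m (coneDZero v φ (Pi.single (Sum.inl q) 1) p) ≠ 0 at hm
      rw [coneDZero_apply, single_inl_comp_inl, single_inl_comp_inr, map_zero, smul_zero,
        add_zero] at hm
      exact F.graded 0 q p m hm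
    · change coeff m (coneDZero v φ (Pi.single (Sum.inr q) 1) p) ≠ 0 at hm
      rw [coneDZero_apply, single_inr_comp_inl, single_inr_comp_inr, map_zero, zero_add] at hm
      exact hXφ 0 q p m hm
    · change coeff m (coneDSucc v φ i (Pi.single (Sum.inl q) 1) p) ≠ 0 at hm
      rw [coneDSucc_apply, single_inl_comp_inl, single_inl_comp_inr, map_zero, smul_zero, map_zero,
        add_zero, neg_zero] at hm
      rcases p with p | p
      · exact F.graded (i + 1) q p m hm
      · exact absurd rfl hm
    · change coeff m (coneDSucc v φ i (Pi.single (Sum.inr q) 1) p) ≠ 0 at hm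
      rw [coneDSucc_apply, single_inr_comp_inl, single_inr_comp_inr, map_zero, zero_add] at hm
      rcases p with p | p
      · exact hXφ (i + 1) q p m hm
      · have h1 := G.graded i q p m fun h0 => hm (by simp [h0])
        change m.degree + (G.deg i p + c.degree + 1) = G.deg (i + 1) q + c.degree + 1 + 0
        simp only at h1
        omega
  · rintro (_ | i) (q | q) p
    · change coeff 0 (coneDZero v φ (Pi.single (Sum.inl q) 1) p) = 0
      rw [coneDZero_apply, single_inl_comp_inl, single_inl_comp_inr, map_zero, smul_zero, add_zero]
      exact F.minimal 0 q p
    · change coeff 0 (coneDZero v φ (Pi.single (Sum.inr q) 1) p) = 0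
      rw [coneDZero_apply, single_inr_comp_inl, single_inr_comp_inr, map_zero, zero_add]
      exact hXc _
    · change coeff 0 (coneDSucc v φ i (Pi.single (Sum.inl q) 1) p) = 0
      rw [coneDSucc_apply, single_inl_comp_inl, single_inl_comp_inr, map_zero, smul_zero, map_zero,
        add_zero, neg_zero]
      rcases p with p | p
      · exact F.minimal (i + 1) q p
      · rfl
    · change coeff 0 (coneDSucc v φ i (Pi.single (Sum.inr q) 1) p) = 0
      rw [coneDSucc_apply, single_inr_comp_inl, single_inr_comp_inr, map_zero, zero_add]
      rcases p with p | p
      · exact hXc _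
      · simp [G.minimal i q p]
  · rintro (_ | i) p
    · exact (hF.1 0 p).trans (by omega)
    · rcases p with p | p
      · exact (hF.1 (i + 1) p).trans (by omega)
      · have := hG.1 i p
        change G.deg i p + c.degree + 1 ≤ _
        omega
  · rcases le_total r₁ (r₂ + c.degree) with hr | hr
    · obtain ⟨i, p, hp⟩ := hG.2
      refine ⟨i + 1, Sum.inr p, ?_⟩
      change G.deg i p + c.degree + 1 = _
      rw [max_eq_right hr, hp]; omega
    · obtain ⟨i, p, hp⟩ := hF.2
      rw [max_eq_left hr]
      rcases i with _ | i
      · exact ⟨0, p, hp⟩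
      · exact ⟨i + 1, Sum.inl p, hp⟩

end Cone

theorem exists_top : ∃ E : CyclicResolution (monomialIdeal K (⊤ : UpperSet (Fin n →₀ ℕ))),
    E.HasReg 0 := by
  refine ⟨{ idx := fun i => {_u : Unit // i = 0}
            fintype := fun i => inferInstance
            decEq := fun i => inferInstance
            deg := fun _ _ => 0
            root := ⟨(), rfl⟩
            eq_root := fun _ => rfl
            deg_root := rfl
            d := fun _ => 0
            graded := fun i q p m hm => absurd rfl hm
            minimal := fun _ _ _ => rfl
            exact_zero := fun x => ?_
            exact_succ := fun i x => ?_ }, by simp, 0, ⟨(), rfl⟩, rfl⟩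
  · rw [monomialIdeal_top, Ideal.mem_bot]
    constructor
    · rintro ⟨y, rfl⟩; rfl
    · intro h
      refine ⟨0, ?_⟩
      funext p
      exact h.symm
  · have : IsEmpty {_u : Unit // i + 1 = 0} := ⟨fun p => by simpa using p.2⟩
    exact ⟨fun _ => rfl, fun _ => ⟨0, Subsingleton.elim _ _⟩⟩

end CyclicResolution

/-- Transport along enumerations of the index types; vanishing constant terms become membership in
`(x_1, …, x_n)`. -/
theorem CyclicResolution.hasRegularity {I : Ideal (MvPolynomial (Fin n) K)}
    (F : CyclicResolution I) {r : ℕ} (h : F.HasReg r) : HasRegularity I (r : ℤ) := by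
  let e : ∀ i, F.idx i ≃ Fin (Fintype.card (F.idx i)) := fun i => Fintype.equivFin _
  have hsingle : ∀ i q, LinearMap.funLeft (MvPolynomial (Fin n) K) (MvPolynomial (Fin n) K) (e i)
      (Pi.single q 1) = Pi.single ((e i).symm q) 1 := by
    intro i q
    ext1 p
    simp only [LinearMap.funLeft_apply, Pi.single_apply, Equiv.eq_symm_apply]
  let d : ∀ i, (Fin (Fintype.card (F.idx (i + 1))) → MvPolynomial (Fin n) K)
      →ₗ[MvPolynomial (Fin n) K] (Fin (Fintype.card (F.idx i)) → MvPolynomial (Fin n) K) :=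
    fun i => (LinearMap.funLeft _ _ (e i).symm).comp
      ((F.d i).comp (LinearMap.funLeft _ _ (e (i + 1))))
  have hd : ∀ i q p, d i (Pi.single q 1) p =
      F.d i (Pi.single ((e (i + 1)).symm q) 1) ((e i).symm p) := by
    intro i q p
    simp only [d, LinearMap.comp_apply, hsingle]
    rfl
  have hrange : ∀ i x, (∃ y, d i y = x) ↔ ∃ y, F.d i y = x ∘ e i := by
    intro i x
    constructor
    · rintro ⟨y, rfl⟩
      refine ⟨y ∘ e (i + 1), ?_⟩
      ext1 p
      simp [d, LinearMap.funLeft_apply]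
      rfl
    · rintro ⟨y, hy⟩
      refine ⟨y ∘ (e (i + 1)).symm, ?_⟩
      ext1 p
      have : (y ∘ (e (i + 1)).symm) ∘ e (i + 1) = y := by ext1 q; simp
      have h2 := congrFun hy ((e i).symm p)
      simp only [Function.comp_apply, Equiv.apply_symm_apply] at h2
      rw [← h2]
      change F.d i ((y ∘ (e (i + 1)).symm) ∘ e (i + 1)) _ = _
      rw [this]
  have hker : ∀ i x, d i x = 0 ↔ F.d i (x ∘ e (i + 1)) = 0 := by
    intro i x
    constructor
    · intro h
      ext1 p
      have := congrFun h (e i p)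
      simp only [d, LinearMap.comp_apply, LinearMap.funLeft_apply, Equiv.symm_apply_apply] at this
      exact this
    · intro h
      ext1 p
      exact congrFun h ((e i).symm p)
  refine ⟨{ rank := fun i => Fintype.card (F.idx i)
            degree := fun i p => F.deg i ((e i).symm p)
            aug := (Ideal.Quotient.mkₐ (MvPolynomial (Fin n) K) I).toLinearMap.comp
              (LinearMap.proj (e 0 F.root))
            d := d
            aug_homogeneous := fun p => ⟨1, ?_, ?_⟩
            d_homogeneous := fun i q p => ?_
            aug_surjective := fun x => ?_
            exact_zero := fun x => ?_
            exact_succ := fun i x => ?_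
            minimal := fun i q p => ?_ }, ⟨?_, ?_⟩⟩
  · rw [F.eq_root ((e 0).symm p), F.deg_root]
    exact isHomogeneous_one _ _
  · have : p = e 0 F.root := by rw [← F.eq_root ((e 0).symm p), Equiv.apply_symm_apply]
    subst this
    simp
  · rw [or_iff_not_imp_left]
    intro hne
    obtain ⟨m, hm⟩ := ne_zero_iff.1 hne
    have H := fun m (hm : coeff m (d i (Pi.single q 1) p) ≠ 0) =>
      F.graded i ((e (i + 1)).symm q) ((e i).symm p) m (by rwa [← hd])
    refine ⟨m.degree, ?_, fun m' hm' => ?_⟩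
    · have := H m hm
      simp only at this
      omega
    · have h1 := H m hm
      have h2 := H m' hm'
      simp only at h1 h2
      have h3 : Finsupp.weight (1 : Fin n → ℕ) m' = m'.degree := by
        rw [Finsupp.degree_eq_weight_one]; rfl
      omega
  · obtain ⟨f, rfl⟩ := Ideal.Quotient.mk_surjective x
    exact ⟨fun _ => f, rfl⟩
  · change Ideal.Quotient.mk I (x (e 0 F.root)) = 0 ↔ ∃ y, d 0 y = x
    rw [Ideal.Quotient.eq_zero_iff_mem, hrange, F.exact_zero]
    rfl
  · change d i x = 0 ↔ ∃ y, d (i + 1) y = x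
    rw [hrange, F.exact_succ, hker]
  · have h0 := F.minimal i ((e (i + 1)).symm q) ((e i).symm p)
    rw [← hd] at h0
    rw [← Set.image_univ, mem_ideal_span_X_image]
    intro m hm
    have hm0 : m ≠ 0 := by
      rintro rfl
      exact (mem_support_iff.1 hm) h0
    obtain ⟨s, hs⟩ := Finsupp.ne_iff.1 hm0
    exact ⟨s, trivial, hs⟩
  · obtain ⟨i, p, hp⟩ := h.2
    refine ⟨i, e i p, ?_⟩
    simp [hp]
  · rintro s ⟨i, p, rfl⟩
    have := h.1 i ((e i).symm p)
    simp only
    omega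

end Resolutions

/-! ### A functional detecting the cycle of an induced matching. -/

section Transversals

variable {K : Type*} [Field K] {n : ℕ}

/-- The exponents of the products that contain exactly one variable of each pair. -/
def transversals : List (Fin n × Fin n) → Set (Fin n →₀ ℕ)
  | [] => {0}
  | p :: ps => {m | ∃ m' ∈ transversals ps,
      m = Finsupp.single p.1 1 + m' ∨ m = Finsupp.single p.2 1 + m'}

/-- The pairs form an induced matching of the graph `H`. -/
def IsInducedMatching (H : SimpleGraph (Fin n)) : List (Fin n × Fin n) → Prop
  | [] => True
  | p :: ps => H.Adj p.1 p.2 ∧ (∀ q ∈ ps, ¬H.Adj p.1 q.1 ∧ ¬H.Adj p.1 q.2 ∧ ¬H.Adj p.2 q.1 ∧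
      ¬H.Adj p.2 q.2) ∧ IsInducedMatching H ps

theorem IsInducedMatching.adj {H : SimpleGraph (Fin n)} {ps : List (Fin n × Fin n)}
    (h : IsInducedMatching H ps) : ∀ q ∈ ps, H.Adj q.1 q.2 := by
  induction ps with
  | nil => simp
  | cons p ps ih =>
    intro q hq
    rcases List.mem_cons.1 hq with rfl | hq
    · exact h.1
    · exact ih h.2.2 q hq

theorem exists_mem_of_mem_transversals {ps : List (Fin n × Fin n)} {m : Fin n →₀ ℕ}
    (hm : m ∈ transversals ps) {x : Fin n} (hx : m x ≠ 0) : ∃ q ∈ ps, x = q.1 ∨ x = q.2 := by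
  induction ps generalizing m with
  | nil => exact absurd (by rw [show m = 0 from hm]; rfl) hx
  | cons p ps ih =>
    obtain ⟨m', hm', h⟩ := hm
    by_cases hx' : m' x = 0
    · refine ⟨p, List.mem_cons_self, ?_⟩
      by_contra! hne
      rcases h with rfl | rfl <;> simp [hx', hne.1, hne.2] at hx
    · obtain ⟨q, hq, h⟩ := ih hm' hx'
      exact ⟨q, List.mem_cons_of_mem _ hq, h⟩

/-- The functional that detects the class of a linear monomial cycle of an induced matching. -/
def matchingFunctional : List (Fin n × Fin n) → (Finset (Fin n) → MvPolynomial (Fin n) K) → K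
  | [], z => coeff 0 (z ∅)
  | p :: ps, z => matchingFunctional ps (mapCoord (divX p.1) (coordContract p.2 z) +
      mapCoord (divX p.2) (coordContract p.1 z))

theorem IsInducedMatching.head_ne {H : SimpleGraph (Fin n)} {p : Fin n × Fin n}
    {ps : List (Fin n × Fin n)} (h : IsInducedMatching H (p :: ps)) :
    ∀ q ∈ ps, p.1 ≠ q.1 ∧ p.1 ≠ q.2 ∧ p.2 ≠ q.1 ∧ p.2 ≠ q.2 := by
  intro q hq
  have h1 := h.2.1 q hq
  have h2 := h.2.2.adj q hq
  refine ⟨?_, ?_, ?_, ?_⟩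
  · intro e; rw [← e] at h2; exact h1.2.1 h2
  · intro e; rw [← e] at h2; exact h1.1 h2.symm
  · intro e; rw [← e] at h2; exact h1.2.2.2 h2
  · intro e; rw [← e] at h2; exact h1.2.2.1 h2.symm

theorem coordD_contract (s : Fin n) (z : Finset (Fin n) → MvPolynomial (Fin n) K) :
    coordD K (coordContract s z) = -coordContract s (coordD K z) := by
  rw [coordD_def, coordD_def, map_sum, ← Finset.sum_neg_distrib]
  refine Finset.sum_congr rfl fun t _ => ?_
  rw [coordContract_smul]
  by_cases h : t = s
  · subst h; rw [coordContract_self, smul_zero, neg_zero]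
  · rw [coordContract_comm h, smul_neg]

theorem coeff_coordContract_eq_zero {m : Fin n →₀ ℕ}
    {q : Finset (Fin n) → MvPolynomial (Fin n) K} (hq : ∀ T, coeff m (q T) = 0) (s : Fin n)
    (T : Finset (Fin n)) : coeff m (coordContract s q T) = 0 := by
  rw [coordContract_apply]
  split_ifs
  · rfl
  · rw [coeff_smul, hq, smul_zero]

/-- One step of the functional sends boundaries to boundaries, up to multiples of `x_w` and `x_v`.
Those are invisible to the transversals of the remaining pairs, so the error term keeps its defining
property. After the last step only the constant coefficient at `∅` is read, and it vanishes on
boundaries. -/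
theorem matchingFunctional_boundary {H : SimpleGraph (Fin n)} {ps : List (Fin n × Fin n)}
    (h : IsInducedMatching H ps) (y q : Finset (Fin n) → MvPolynomial (Fin n) K)
    (hq : ∀ T, ∀ m ∈ transversals ps, coeff m (q T) = 0) :
    matchingFunctional ps (coordD K y + q) = 0 := by
  induction ps generalizing y q with
  | nil =>
    rw [matchingFunctional, Pi.add_apply, coeff_add, hq ∅ 0 rfl, add_zero, coordD_apply, coeff_sum]
    refine Finset.sum_eq_zero fun s _ => ?_
    simp [coeff_X_mul']
  | cons p ps ih =>
    obtain ⟨w, v⟩ := p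
    rw [matchingFunctional]
    -- The sum is symmetric in `w` and `v` so that the contraction terms of `coordD_divX` cancel,
    -- the two contractions being anticommuting.
    have key : mapCoord (divX w) (coordContract v (coordD K y + q)) +
        mapCoord (divX v) (coordContract w (coordD K y + q)) =
        coordD K (-(mapCoord (divX w) (coordContract v y) +
          mapCoord (divX v) (coordContract w y))) +
        ((X w : MvPolynomial (Fin n) K) • mapCoord (divX w) (coordContract w (coordContract v y)) +
        (X v : MvPolynomial (Fin n) K) • mapCoord (divX v) (coordContract v (coordContract w y)) +
        (mapCoord (divX w) (coordContract v q) + mapCoord (divX v) (coordContract w q))) := by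
      rw [map_neg, map_add (coordD K), coordD_divX, coordD_divX, coordD_contract, coordD_contract,
        coordContract_comm (s := w) (t := v) h.1.ne]
      simp only [map_add, map_neg]
      abel
    dsimp only at key ⊢
    rw [key]
    refine ih h.2.2 _ _ fun T m hm => ?_
    have hne : ∀ x, (x = w ∨ x = v) → m x = 0 := by
      intro x hx
      by_contra h0
      obtain ⟨r, hr, h1⟩ := exists_mem_of_mem_transversals hm h0
      have h2 := h.head_ne r hr
      dsimp only at h2
      rcases hx with rfl | rfl <;> rcases h1 with h1 | h1 <;> tauto
    have hXw : ∀ f : MvPolynomial (Fin n) K, coeff m (X w * f) = 0 := fun f => by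
      rw [coeff_X_mul', if_neg (by simp [hne w (Or.inl rfl)])]
    have hXv : ∀ f : MvPolynomial (Fin n) K, coeff m (X v * f) = 0 := fun f => by
      rw [coeff_X_mul', if_neg (by simp [hne v (Or.inr rfl)])]
    simp only [Pi.add_apply, Pi.smul_apply, smul_eq_mul, coeff_add, hXw, hXv, mapCoord_apply,
      coeff_divX, zero_add]
    rw [coeff_coordContract_eq_zero (fun T => hq T _ ⟨m, hm, Or.inl rfl⟩),
      coeff_coordContract_eq_zero (fun T => hq T _ ⟨m, hm, Or.inr rfl⟩), add_zero]

theorem divX_monomial_of_eq_zero {s : Fin n} {m : Fin n →₀ ℕ} (hm : m s = 0) (c : K) :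
    divX s (monomial m c) = 0 := by
  ext m'
  rw [coeff_divX, coeff_monomial, if_neg]
  · rfl
  · rintro rfl
    simp at hm

theorem divX_monomial_single_add (s : Fin n) (m : Fin n →₀ ℕ) (c : K) :
    divX s (monomial (Finsupp.single s 1 + m) c) = monomial m c := by
  ext m'
  rw [coeff_divX, coeff_monomial, coeff_monomial]
  simp

theorem mapCoord_single (f : MvPolynomial (Fin n) K →+ MvPolynomial (Fin n) K)
    (T : Finset (Fin n)) (g : MvPolynomial (Fin n) K) :
    mapCoord f (Pi.single T g) = Pi.single T (f g) := by
  ext1 U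
  rw [mapCoord_apply]
  by_cases h : U = T
  · subst h; simp
  · simp [h]

/-- The exponent of the product of the first members of the pairs. -/
def firstExponent (ps : List (Fin n × Fin n)) : Fin n →₀ ℕ :=
  (ps.map fun p => Finsupp.single p.1 1).sum

/-- The set of the second members of the pairs. -/
def secondSet (ps : List (Fin n × Fin n)) : Finset (Fin n) := (ps.map Prod.snd).toFinset

theorem firstExponent_apply_eq_zero {ps : List (Fin n × Fin n)} {x : Fin n}
    (h : ∀ q ∈ ps, x ≠ q.1) : firstExponent ps x = 0 := by
  induction ps with
  | nil => rfl
  | cons p ps ih =>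
    rw [firstExponent, List.map_cons, List.sum_cons, Finsupp.add_apply]
    rw [Finsupp.single_eq_of_ne (h p List.mem_cons_self), zero_add]
    exact ih fun q hq => h q (List.mem_cons_of_mem _ hq)

/-- In each step only the summand dividing by `x_w` and contracting with `e_v` survives, since `x_v`
does not divide the monomial. The result is `c` up to sign. -/
theorem matchingFunctional_single {H : SimpleGraph (Fin n)} {ps : List (Fin n × Fin n)}
    (h : IsInducedMatching H ps) {c : K}
    (hc : matchingFunctional ps (Pi.single (secondSet ps) (monomial (firstExponent ps) c)) = 0) :
    c = 0 := by
  induction ps generalizing c with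
  | nil =>
    change coeff 0 ((Pi.single ∅ (monomial 0 c) : Finset (Fin n) → MvPolynomial (Fin n) K) ∅) = 0
      at hc
    simpa using hc
  | cons p ps ih =>
    obtain ⟨w, v⟩ := p
    have hne := h.head_ne
    have hv : v ∉ secondSet ps := by
      intro hv
      obtain ⟨q, hq, rfl⟩ := List.mem_map.1 (List.mem_toFinset.1 hv)
      exact (hne q hq).2.2.2 rfl
    have hs : secondSet ((w, v) :: ps) = insert v (secondSet ps) := by simp [secondSet]
    have hf : firstExponent ((w, v) :: ps) = Finsupp.single w 1 + firstExponent ps := by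
      simp [firstExponent]
    have hf0 : (Finsupp.single w 1 + firstExponent ps : Fin n →₀ ℕ) v = 0 := by
      rw [Finsupp.add_apply, firstExponent_apply_eq_zero fun q hq => (hne q hq).2.2.1,
        Finsupp.single_eq_of_ne h.1.ne.symm]
    have h1 : mapCoord (divX v) (coordContract w (Pi.single (insert v (secondSet ps))
        (monomial (Finsupp.single w 1 + firstExponent ps) c))) = 0 := by
      rw [← coordContract_mapCoord, mapCoord_single, divX_monomial_of_eq_zero hf0, Pi.single_zero,
        map_zero]
    rw [matchingFunctional] at hc
    dsimp only at hc
    rw [hs, hf, h1, add_zero, ← coordContract_mapCoord, mapCoord_single, divX_monomial_single_add,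
      coordContract_single, if_pos (Finset.mem_insert_self _ _), Finset.erase_insert hv,
      ← Pi.single_smul, ← map_zsmul (monomial (firstExponent ps))] at hc
    have h2 := ih h.2.2 hc
    rw [← wedgeSign_smul_smul v (insert v (secondSet ps)) c, h2, smul_zero]

/-- Contraction with vertices outside a set of interest. -/
theorem exists_boundary_of_union (P : (Fin n →₀ ℕ) → Prop) (V A : Finset (Fin n))
    (hA : Disjoint A V) (f : MvPolynomial (Fin n) K)
    (y q : Finset (Fin n) → MvPolynomial (Fin n) K) (hq : ∀ T m, P m → coeff m (q T) = 0)
    (h : Pi.single (A ∪ V) f = coordD K y + q) :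
    ∃ (ε : ℤˣ) (y' q' : Finset (Fin n) → MvPolynomial (Fin n) K),
      (∀ T m, P m → coeff m (q' T) = 0) ∧ Pi.single V ((ε : ℤ) • f) = coordD K y' + q' := by
  induction A using Finset.induction_on generalizing f y q with
  | empty => exact ⟨1, y, q, hq, by simpa using h⟩
  | insert a A ha ih =>
    have haV : a ∉ V := Finset.disjoint_left.1 hA (Finset.mem_insert_self _ _)
    -- Contraction with `e_a^*` removes `a` from the index set, keeps boundaries boundaries because
    -- it anticommutes with `d`, and only changes signs in the coefficients.
    have h1 := congrArg (coordContract a) h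
    rw [coordContract_single, if_pos (by simp), map_add, ← neg_neg (coordContract a (coordD K y)),
      ← coordD_contract, ← map_neg, ← Pi.single_smul, Finset.insert_union,
      Finset.erase_insert (by simp [ha, haV])] at h1
    obtain ⟨ε, y', q', hq', h2⟩ := ih (hA.mono_left (Finset.subset_insert _ _)) _ _ _
      (fun T m hm => coeff_coordContract_eq_zero (fun T => hq T m hm) a T) h1
    refine ⟨ε * (-1) ^ ((insert a (A ∪ V)).filter (· < a)).card, y', q', hq', ?_⟩
    rw [← h2, smul_smul]
    simp [wedgeSign]

end Transversals

/-! ### Edge ideals of graphs, leaf removal and star families. -/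

section Graphs

variable {n : ℕ}

/-- The exponents of the monomials in the ideal generated by the edges of `H` and the variables
in `S`. -/
def graphUpperSet (H : SimpleGraph (Fin n)) (S : Finset (Fin n)) : UpperSet (Fin n →₀ ℕ) where
  carrier := {m | (∃ i j, H.Adj i j ∧ m i ≠ 0 ∧ m j ≠ 0) ∨ ∃ s ∈ S, m s ≠ 0}
  upper' := by
    have hle : ∀ {a b : Fin n →₀ ℕ}, a ≤ b → ∀ i, a i ≠ 0 → b i ≠ 0 := fun {a b} h i hi => by
      have := h i
      omega
    rintro a b hab (⟨i, j, h, hi, hj⟩ | ⟨s, hs, h⟩)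
    · exact Or.inl ⟨i, j, h, hle hab i hi, hle hab j hj⟩
    · exact Or.inr ⟨s, hs, hle hab s h⟩

theorem mem_graphUpperSet {H : SimpleGraph (Fin n)} {S : Finset (Fin n)} {m : Fin n →₀ ℕ} :
    m ∈ graphUpperSet H S ↔
      (∃ i j, H.Adj i j ∧ m i ≠ 0 ∧ m j ≠ 0) ∨ ∃ s ∈ S, m s ≠ 0 := Iff.rfl

theorem graphUpperSet_bot : graphUpperSet (⊥ : SimpleGraph (Fin n)) ∅ = ⊤ := by
  ext m
  simp [mem_graphUpperSet]

/-- The graph obtained by deleting all edges at the vertices in `A`. -/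
def deleteVertices (H : SimpleGraph (Fin n)) (A : Set (Fin n)) : SimpleGraph (Fin n) where
  Adj i j := H.Adj i j ∧ i ∉ A ∧ j ∉ A
  symm := ⟨fun _ _ h => ⟨h.1.symm, h.2.2, h.2.1⟩⟩
  loopless := ⟨fun _ h => h.1.ne rfl⟩

theorem deleteVertices_adj {H : SimpleGraph (Fin n)} {A : Set (Fin n)} {i j : Fin n} :
    (deleteVertices H A).Adj i j ↔ H.Adj i j ∧ i ∉ A ∧ j ∉ A := Iff.rfl

theorem deleteVertices_lt {H : SimpleGraph (Fin n)} {A : Set (Fin n)} {i j : Fin n}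
    (h : H.Adj i j) (hi : i ∈ A) : deleteVertices H A < H := by
  refine lt_of_le_of_ne (fun _ _ h => h.1) fun heq => ?_
  rw [← heq] at h
  exact h.2.1 hi

/-- No generator involves `x_u`, so it is a nonzerodivisor modulo the old ideal and the colon ideal
is that ideal itself; here `c = 0`. -/
theorem isMonomialStep_insert {H : SimpleGraph (Fin n)} {S : Finset (Fin n)} {u : Fin n}
    (hu : ∀ j, ¬H.Adj u j) (huS : u ∉ S) :
    IsMonomialStep (graphUpperSet H (insert u S)) (graphUpperSet H S) (graphUpperSet H S) u 0 where
  mem_iff m := by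
    simp only [mem_graphUpperSet, Finset.mem_insert, add_zero, Finsupp.single_le_iff,
      Nat.one_le_iff_ne_zero]
    constructor
    · rintro (h | ⟨s, rfl | hs, h⟩)
      · exact Or.inl (Or.inl h)
      · exact Or.inr h
      · exact Or.inl (Or.inr ⟨s, hs, h⟩)
    · rintro ((h | ⟨s, hs, h⟩) | h)
      · exact Or.inl h
      · exact Or.inr ⟨s, Or.inr hs, h⟩
      · exact Or.inr ⟨u, Or.inl rfl, h⟩
  mem_colon_iff m := by
    have hm : ∀ i, i ≠ u → (Finsupp.single u 1 + 0 + m : Fin n →₀ ℕ) i = m i := fun i hi => by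
      simp [hi.symm]
    simp only [mem_graphUpperSet]
    constructor
    · rintro (⟨i, j, h, hi, hj⟩ | ⟨s, hs, h⟩)
      · refine Or.inl ⟨i, j, h, ?_, ?_⟩
        · rwa [hm i (by rintro rfl; exact hu j h)]
        · rwa [hm j (by rintro rfl; exact hu i h.symm)]
      · refine Or.inr ⟨s, hs, ?_⟩
        rwa [hm s (by rintro rfl; exact huS hs)]
    · rintro (⟨i, j, h, hi, hj⟩ | ⟨s, hs, h⟩)
      · rw [hm i (by rintro rfl; exact hu j h)] at hi
        rw [hm j (by rintro rfl; exact hu i h.symm)] at hj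
        exact Or.inl ⟨i, j, h, hi, hj⟩
      · rw [hm s (by rintro rfl; exact huS hs)] at h
        exact Or.inr ⟨s, hs, h⟩
  colon_stable m hm := by rwa [zero_add]

open Classical in
/-- The neighbours of `w`. -/
def neighbors (H : SimpleGraph (Fin n)) (w : Fin n) : Finset (Fin n) :=
  Finset.univ.filter (H.Adj w)

theorem mem_neighbors {H : SimpleGraph (Fin n)} {w u : Fin n} :
    u ∈ neighbors H w ↔ H.Adj w u := by
  simp [neighbors]

/-- The only edge at `v` is `vw`, and `x_v` does not occur in `J`. The colon by `x_w` turns the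
edges at `w` into the variables of its other neighbours, which absorb all edges meeting them. -/
theorem isMonomialStep_leaf {H : SimpleGraph (Fin n)} {v w : Fin n} (hvw : H.Adj v w)
    (hleaf : ∀ u, H.Adj v u → u = w) :
    IsMonomialStep (graphUpperSet H ∅) (graphUpperSet (deleteVertices H {v}) ∅)
      (graphUpperSet (deleteVertices H (insert w {u | H.Adj w u})) ((neighbors H w).erase v))
      v (Finsupp.single w 1) where
  mem_iff m := by
    simp only [mem_graphUpperSet, Finset.notMem_empty, false_and, exists_false, or_false,
      deleteVertices_adj, Set.mem_singleton_iff]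
    constructor
    · rintro ⟨i, j, h, hi, hj⟩
      by_cases hiv : i = v
      · subst hiv
        obtain rfl := hleaf j h
        right
        intro x
        by_cases hx : x = i
        · subst hx; simp [hvw.ne]; omega
        · by_cases hx' : x = j
          · subst hx'; simp [hvw.ne]; omega
          · simp [Ne.symm hx, Ne.symm hx']
      · by_cases hjv : j = v
        · subst hjv
          obtain rfl := hleaf i h.symm
          right
          intro x
          by_cases hx : x = i
          · subst hx; simp [hvw.ne]; omega
          · by_cases hx' : x = j
            · subst hx'; simp [hvw.ne]; omega
            · simp [Ne.symm hx, Ne.symm hx']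
        · exact Or.inl ⟨i, j, ⟨h, hiv, hjv⟩, hi, hj⟩
    · rintro (⟨i, j, h, hi, hj⟩ | h)
      · exact ⟨i, j, h.1, hi, hj⟩
      · refine ⟨v, w, hvw, ?_, ?_⟩
        · have := h v
          simp at this
          omega
        · have := h w
          simp at this
          omega
  mem_colon_iff m := by
    simp only [mem_graphUpperSet, Finset.notMem_empty, false_and, exists_false, or_false,
      deleteVertices_adj, Set.mem_singleton_iff, Set.mem_insert_iff, Set.mem_ofPred_eq,
      Finset.mem_erase, mem_neighbors]
    have hm : ∀ i, i ≠ v → i ≠ w →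
        (Finsupp.single v 1 + Finsupp.single w 1 + m : Fin n →₀ ℕ) i = m i := fun i hi hi' => by
      simp [hi.symm, hi'.symm]
    have hle : ∀ i, m i ≠ 0 →
        (Finsupp.single v 1 + Finsupp.single w 1 + m : Fin n →₀ ℕ) i ≠ 0 := fun i hi => by
      simp [hi]
    have hw : (Finsupp.single v 1 + Finsupp.single w 1 + m : Fin n →₀ ℕ) w ≠ 0 := by simp
    constructor
    · rintro (⟨i, j, ⟨h, h1, h2⟩, hi, hj⟩ | ⟨s, ⟨hsv, hs⟩, hms⟩)
      · refine ⟨i, j, ⟨h, ?_, ?_⟩, hle i hi, hle j hj⟩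
        · rintro rfl; exact h1 (Or.inr hvw.symm)
        · rintro rfl; exact h2 (Or.inr hvw.symm)
      · exact ⟨w, s, ⟨hs, hvw.ne.symm, hsv⟩, hw, hle s hms⟩
    · rintro ⟨i, j, ⟨h, hiv, hjv⟩, hi, hj⟩
      by_cases hiw : i = w
      · subst hiw
        rw [hm j hjv h.ne.symm] at hj
        exact Or.inr ⟨j, ⟨hjv, h⟩, hj⟩
      by_cases hjw : j = w
      · subst hjw
        rw [hm i hiv hiw] at hi
        exact Or.inr ⟨i, ⟨hiv, h.symm⟩, hi⟩
      rw [hm i hiv hiw] at hi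
      rw [hm j hjv hjw] at hj
      by_cases hwi : H.Adj w i
      · exact Or.inr ⟨i, ⟨hiv, hwi⟩, hi⟩
      by_cases hwj : H.Adj w j
      · exact Or.inr ⟨j, ⟨hjv, hwj⟩, hj⟩
      exact Or.inl ⟨i, j, ⟨h, by tauto, by tauto⟩, hi, hj⟩
  colon_stable m := by
    simp only [mem_graphUpperSet, Finset.notMem_empty, false_and, exists_false, or_false,
      deleteVertices_adj, Set.mem_singleton_iff, Set.mem_insert_iff, Set.mem_ofPred_eq,
      Finset.mem_erase, mem_neighbors]
    have hle : ∀ i, m i ≠ 0 → (Finsupp.single w 1 + m : Fin n →₀ ℕ) i ≠ 0 := fun i hi => by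
      simp [hi]
    rintro (⟨i, j, ⟨h, h1, h2⟩, hi, hj⟩ | ⟨s, ⟨hsv, hs⟩, hms⟩)
    · refine ⟨i, j, ⟨h, ?_, ?_⟩, hle i hi, hle j hj⟩
      · rintro rfl; exact h1 (Or.inr hvw.symm)
      · rintro rfl; exact h2 (Or.inr hvw.symm)
    · exact ⟨w, s, ⟨hs, hvw.ne.symm, hsv⟩, by simp, hle s hms⟩

/-- A vertex `center`, one of its neighbours `leaf` and a set `rays` of neighbours. -/
structure Star (n : ℕ) where
  center : Fin n
  leaf : Fin n
  rays : Finset (Fin n)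

/-- The stars have disjoint rays, and their edges `center — leaf` form an induced matching. -/
def IsStarFamily (H : SimpleGraph (Fin n)) : List (Star n) → Prop
  | [] => True
  | t :: ts => t.leaf ∈ t.rays ∧ (∀ u ∈ t.rays, H.Adj t.center u) ∧
      (∀ s ∈ ts, (¬H.Adj t.center s.center ∧ ¬H.Adj t.center s.leaf ∧ ¬H.Adj t.leaf s.center ∧
        ¬H.Adj t.leaf s.leaf) ∧ Disjoint t.rays s.rays) ∧ IsStarFamily H ts

theorem IsStarFamily.isInducedMatching {H : SimpleGraph (Fin n)} {ts : List (Star n)}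
    (h : IsStarFamily H ts) : IsInducedMatching H (ts.map fun t => (t.center, t.leaf)) := by
  induction ts with
  | nil => trivial
  | cons t ts ih =>
    refine ⟨h.2.1 _ h.1, fun q hq => ?_, ih h.2.2.2⟩
    obtain ⟨s, hs, rfl⟩ := List.mem_map.1 hq
    exact (h.2.2.1 s hs).1

/-- All vertices of the stars are ends of surviving edges, hence outside `A`. Between such vertices
both graphs have the same edges, so the matching stays induced. -/
theorem IsStarFamily.of_deleteVertices {H : SimpleGraph (Fin n)} {A : Set (Fin n)}
    {ts : List (Star n)} (h : IsStarFamily (deleteVertices H A) ts) :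
    IsStarFamily H ts ∧ ∀ t ∈ ts, t.center ∉ A ∧ t.leaf ∉ A ∧ ∀ u ∈ t.rays, u ∉ A := by
  induction ts with
  | nil => exact ⟨trivial, by simp⟩
  | cons t ts ih =>
    obtain ⟨ih1, ih2⟩ := ih h.2.2.2
    have ht : t.center ∉ A ∧ t.leaf ∉ A ∧ ∀ u ∈ t.rays, u ∉ A :=
      ⟨(h.2.1 _ h.1).2.1, (h.2.1 _ h.1).2.2, fun u hu => (h.2.1 u hu).2.2⟩
    refine ⟨⟨h.1, fun u hu => (h.2.1 u hu).1, fun s hs => ⟨?_, (h.2.2.1 s hs).2⟩, ih1⟩, ?_⟩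
    · have h1 := (h.2.2.1 s hs).1
      have h2 := ih2 s hs
      simp only [deleteVertices_adj] at h1
      tauto
    · intro s hs
      rcases List.mem_cons.1 hs with rfl | hs
      · exact ht
      · exact ih2 s hs

/-- The old stars avoid `N[w]`, and `v` has no neighbour but `w`; so nothing joins the edge `wv` to
the old matching, and the rays are disjoint. -/
theorem IsStarFamily.cons_leaf {H : SimpleGraph (Fin n)} {v w : Fin n} (hvw : H.Adj v w)
    (hleaf : ∀ u, H.Adj v u → u = w) {ts : List (Star n)}
    (h : IsStarFamily (deleteVertices H (insert w {u | H.Adj w u})) ts) :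
    IsStarFamily H (⟨w, v, neighbors H w⟩ :: ts) := by
  obtain ⟨h1, h2⟩ := h.of_deleteVertices
  refine ⟨mem_neighbors.2 hvw.symm, fun u hu => mem_neighbors.1 hu, fun s hs => ⟨?_, ?_⟩, h1⟩
  · obtain ⟨h3, h4, -⟩ := h2 s hs
    exact ⟨fun h => h3 (Or.inr h), fun h => h4 (Or.inr h), fun h => h3 (Or.inl (hleaf _ h)),
      fun h => h4 (Or.inl (hleaf _ h))⟩
  · exact Finset.disjoint_left.2 fun u hu hu' =>
      (h2 s hs).2.2 u hu' (Or.inr (mem_neighbors.1 hu))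

end Graphs

/-! ### Recursion for regularity and projective dimension. -/

section Invariants

universe u

variable (K : Type u) [Field K] {n : ℕ}

open CategoryTheory

/-- `R/I`, `I` the monomial ideal of `U`, has regularity `r` and projective dimension at
most `p`. -/
structure HasInvariants (U : UpperSet (Fin n →₀ ℕ)) (r p : ℕ) : Prop where
  exists_resolution : ∃ E : CyclicResolution (monomialIdeal K U), E.HasReg r
  koszulVanishesAbove : KoszulVanishesAbove K U r
  hasProjectiveDimensionLT : HasProjectiveDimensionLT (ModuleCat.of (MvPolynomial (Fin n) K)
      (MvPolynomial (Fin n) K ⧸ monomialIdeal K U)) (p + 1)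

variable {K}

theorem IsMonomialStep.hasInvariants {U J Q : UpperSet (Fin n →₀ ℕ)} {v : Fin n}
    {c : Fin n →₀ ℕ} (h : IsMonomialStep U J Q v c) {r₁ p₁ r₂ p₂ : ℕ}
    (hJ : HasInvariants K J r₁ p₁) (hQ : HasInvariants K Q r₂ p₂) :
    HasInvariants K U (max r₁ (r₂ + c.degree)) (max p₁ (p₂ + 1)) where
  exists_resolution := by
    obtain ⟨F, hF⟩ := hJ.exists_resolution
    obtain ⟨G, hG⟩ := hQ.exists_resolution
    exact CyclicResolution.exists_cone F G h hF hG
  koszulVanishesAbove := by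
    -- The vanishing bound is brought to the form `r + c.degree` expected by the monomial step; the
    -- truncated subtraction is harmless because the maximum is at least `c.degree`.
    have hr : max r₁ (r₂ + c.degree) = max r₁ (r₂ + c.degree) - c.degree + c.degree := by omega
    rw [hr]
    exact h.koszulVanishesAbove (hJ.koszulVanishesAbove.mono (by omega))
      (hQ.koszulVanishesAbove.mono (by omega))
  hasProjectiveDimensionLT := by
    have h1 := hJ.hasProjectiveDimensionLT
    have h2 := hQ.hasProjectiveDimensionLT
    exact h.hasProjectiveDimensionLT (hasProjectiveDimensionLT_of_ge _ (p₁ + 1) _ (by omega))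
      (hasProjectiveDimensionLT_of_ge _ (p₂ + 1) _ (by omega))

theorem hasInvariants_top : HasInvariants K (⊤ : UpperSet (Fin n →₀ ℕ)) 0 0 :=
  ⟨CyclicResolution.exists_top, koszulVanishesAbove_top, hasProjectiveDimensionLT_top⟩

/-- Killing a variable that meets no edge leaves the regularity unchanged and raises the bound for
the projective dimension by one. -/
theorem HasInvariants.add_variables {H : SimpleGraph (Fin n)} {r p : ℕ}
    (h : HasInvariants K (graphUpperSet H ∅) r p) (S : Finset (Fin n))
    (hS : ∀ s ∈ S, ∀ j, ¬H.Adj s j) :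
    HasInvariants K (graphUpperSet H S) r (p + S.card) := by
  induction S using Finset.induction_on with
  | empty => exact h
  | insert u S hu ih =>
    have ih' := ih fun s hs => hS s (Finset.mem_insert_of_mem hs)
    have := (isMonomialStep_insert (hS u (Finset.mem_insert_self _ _)) hu).hasInvariants ih' ih'
    rw [Finset.card_insert_of_notMem hu]
    simpa [add_assoc] using this

/-- For a forest, regularity and projective dimension are attained by families of stars. -/
theorem exists_hasInvariants_and_starFamily (H : SimpleGraph (Fin n))
    (hleaf : ∀ G ≤ H, G ≠ ⊥ → ∃ v w, G.Adj v w ∧ ∀ u, G.Adj v u → u = w) :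
    ∃ r p, HasInvariants K (graphUpperSet H ∅) r p ∧
      (∃ ts, IsStarFamily H ts ∧ ts.length = r) ∧
      ∃ ts, IsStarFamily H ts ∧ (ts.map fun t => t.rays.card).sum = p := by
  induction H using WellFoundedLT.induction with
  | ind H ih =>
    by_cases hH : H = ⊥
    · subst hH
      exact ⟨0, 0, by rw [graphUpperSet_bot]; exact hasInvariants_top, ⟨[], trivial, rfl⟩,
        ⟨[], trivial, rfl⟩⟩
    obtain ⟨v, w, hvw, hv⟩ := hleaf H le_rfl hH
    have lt1 : deleteVertices H {v} < H := deleteVertices_lt hvw rfl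
    have lt2 : deleteVertices H (insert w {u | H.Adj w u}) < H :=
      deleteVertices_lt hvw.symm (Or.inl rfl)
    obtain ⟨r₁, p₁, h₁, ⟨ts₁, hts₁, hr₁⟩, ⟨us₁, hus₁, hp₁⟩⟩ :=
      ih _ lt1 fun G hG => hleaf G (hG.trans lt1.le)
    obtain ⟨r₂, p₂, h₂, ⟨ts₂, hts₂, hr₂⟩, ⟨us₂, hus₂, hp₂⟩⟩ :=
      ih _ lt2 fun G hG => hleaf G (hG.trans lt2.le)
    -- The other neighbours of `w` are isolated after deleting `N[w]`. Their number plus one, from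
    -- the cone, is the number of rays of the new star.
    have h₂' := h₂.add_variables ((neighbors H w).erase v) fun s hs j hj =>
      hj.2.1 (Or.inr (mem_neighbors.1 (Finset.mem_of_mem_erase hs)))
    have hcard : ((neighbors H w).erase v).card + 1 = (neighbors H w).card :=
      Finset.card_erase_add_one (mem_neighbors.2 hvw.symm)
    refine ⟨_, _, (isMonomialStep_leaf hvw hv).hasInvariants h₁ h₂', ?_, ?_⟩
    · rw [Finsupp.degree_single]
      rcases le_total r₁ (r₂ + 1) with h | h
      · exact ⟨_, hts₂.cons_leaf hvw hv, by simp [hr₂, h]⟩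
      · exact ⟨_, hts₁.of_deleteVertices.1, by simp [hr₁, h]⟩
    · rw [add_assoc, hcard]
      rcases le_total p₁ (p₂ + (neighbors H w).card) with h | h
      · exact ⟨_, hus₂.cons_leaf hvw hv, by simp [hp₂, h, add_comm]⟩
      · exact ⟨_, hus₁.of_deleteVertices.1, by simp [hp₁, h]⟩

end Invariants

/-! ### From the simplicial complex to its graph of edges. -/

section EdgeIdeals

variable {K : Type*} [Field K] {n : ℕ}

/-- The graph of the edges of `Δ`. -/
def edgeGraph (Δ : AbstractSimplicialComplex (Fin n)) : SimpleGraph (Fin n) where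
  Adj i j := i ≠ j ∧ {i, j} ∈ Δ.faces
  symm := ⟨fun i j h => ⟨h.1.symm, by rw [Finset.pair_comm]; exact h.2⟩⟩
  loopless := ⟨fun _ h => h.1 rfl⟩

theorem single_add_single_le {i j : Fin n} (hij : i ≠ j) {m : Fin n →₀ ℕ} (hi : m i ≠ 0)
    (hj : m j ≠ 0) : Finsupp.single i 1 + Finsupp.single j 1 ≤ m := by
  intro x
  by_cases hx : x = i
  · subst hx; simp [hij]; omega
  · by_cases hx' : x = j
    · subst hx'; simp [hij]; omega
    · simp [Ne.symm hx, Ne.symm hx']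

theorem edgeIdeal_eq_monomialIdeal (Δ : AbstractSimplicialComplex (Fin n)) :
    edgeIdeal K Δ = monomialIdeal K (graphUpperSet (edgeGraph Δ) ∅) := by
  apply le_antisymm
  · refine Ideal.span_le.2 ?_
    rintro f ⟨F, hF, hc, rfl⟩
    obtain ⟨i, j, hij, rfl⟩ := Finset.card_eq_two.1 hc
    rw [Finset.prod_pair hij, X, X, monomial_mul, one_mul]
    exact (monomial_mem_monomialIdeal K).2 (Or.inl ⟨i, j, ⟨hij, hF⟩, by simp, by simp⟩)
  · intro f hf
    rw [f.as_sum]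
    refine sum_mem fun m hm => ?_
    rcases hf m (mem_support_iff.1 hm) with ⟨i, j, h, hi, hj⟩ | ⟨s, hs, -⟩
    · have hle := single_add_single_le h.1 hi hj
      have : monomial m (coeff m f) =
          monomial (m - (Finsupp.single i 1 + Finsupp.single j 1)) (coeff m f) *
            ∏ v ∈ ({i, j} : Finset (Fin n)), X v := by
        rw [Finset.prod_pair h.1, X, X, monomial_mul, monomial_mul, one_mul, mul_one,
          tsub_add_cancel_of_le hle]
      rw [this]
      exact Ideal.mul_mem_left _ _ (Ideal.subset_span ⟨_, h.2, Finset.card_pair h.1, rfl⟩)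
    · simp at hs

theorem two_le_degree_of_mem {H : SimpleGraph (Fin n)} {m : Fin n →₀ ℕ}
    (hm : m ∈ graphUpperSet H ∅) : 2 ≤ m.degree := by
  rcases hm with ⟨i, j, h, hi, hj⟩ | ⟨s, hs, -⟩
  · rw [← tsub_add_cancel_of_le (single_add_single_le h.ne hi hj), map_add, map_add,
      Finsupp.degree_single, Finsupp.degree_single]
    omega
  · simp at hs

theorem leastGeneratorDegree_graph {H : SimpleGraph (Fin n)} {i j : Fin n} (hij : H.Adj i j) :
    leastGeneratorDegree (monomialIdeal K (graphUpperSet H ∅)) = 2 := by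
  have hmem : (Finsupp.single i 1 + Finsupp.single j 1 : Fin n →₀ ℕ) ∈
      minimalGenerators (monomialIdeal K (graphUpperSet H ∅)) := by
    refine ⟨(monomial_mem_monomialIdeal K).2 (Or.inl ⟨i, j, hij, by simp, by simp⟩), ?_⟩
    intro m hm hle
    rcases (monomial_mem_monomialIdeal K).1 hm with ⟨a, b, hab, ha, hb⟩ | ⟨s, hs, -⟩
    · have hx : ∀ x, m x ≠ 0 → x = i ∨ x = j := by
        intro x hx
        by_contra! hne
        have := hle x
        simp [hne.1.symm, hne.2.symm] at this
        exact hx this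
      rcases hx a ha with rfl | rfl <;> rcases hx b hb with rfl | rfl
      · exact absurd rfl hab.ne
      · exact single_add_single_le hij.ne ha hb
      · exact single_add_single_le hij.ne hb ha
      · exact absurd rfl hab.ne
    · simp at hs
  apply le_antisymm
  · refine Nat.sInf_le ⟨_, hmem, ?_⟩
    rw [map_add, Finsupp.degree_single, Finsupp.degree_single]
  · refine le_csInf ⟨_, _, hmem, rfl⟩ ?_
    rintro d ⟨m, hm, rfl⟩
    exact two_le_degree_of_mem ((monomial_mem_monomialIdeal K).1 hm.1)

theorem exists_edge_of_hasDimension {Δ : AbstractSimplicialComplex (Fin n)}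
    (hdim : HasDimension Δ 1) : ∃ i j, (edgeGraph Δ).Adj i j := by
  obtain ⟨F, hF, hc⟩ := hdim.1
  obtain ⟨i, j, hij, rfl⟩ := Finset.card_eq_two.1 hc
  exact ⟨i, j, hij, hF⟩

theorem mem_facets_of_card {Δ : AbstractSimplicialComplex (Fin n)} (hdim : HasDimension Δ 1)
    {F : Finset (Fin n)} (hF : F ∈ Δ.faces) (hc : F.card = 2) : F ∈ facets Δ := by
  refine ⟨hF, fun G hG hFG => ?_⟩
  have hpos : 0 < G.card := Finset.card_pos.2 (Δ.isRelLowerSet_faces hG).1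
  have := hdim.2 (show G.card - 1 ∈ _ from ⟨G, hG, by omega⟩)
  exact (Finset.eq_of_subset_of_card_le hFG (by omega)).ge

theorem exists_leaf_of_isForest {Δ : AbstractSimplicialComplex (Fin n)} (hdim : HasDimension Δ 1)
    (hforest : IsForest Δ) (G : SimpleGraph (Fin n)) (hG : G ≤ edgeGraph Δ) (hne : G ≠ ⊥) :
    ∃ v w, G.Adj v w ∧ ∀ u, G.Adj v u → u = w := by
  have hfacet : ∀ {i j}, G.Adj i j → ({i, j} : Finset (Fin n)) ∈ facets Δ := fun h =>
    mem_facets_of_card hdim (hG h).2 (Finset.card_pair h.ne)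
  obtain ⟨a, b, hab⟩ := SimpleGraph.ne_bot_iff_exists_adj.1 hne
  -- The edges of the subgraph within one component form a nonempty subset of a tree, so they have a
  -- leaf in the sense of facets.
  let T : Set (Finset (Fin n)) := {F | F ∈ component Δ {a, b} ∧ ∃ i j, G.Adj i j ∧ F = {i, j}}
  obtain ⟨F, ⟨hFc, i, j, hij, hF⟩, hleaf⟩ := (hforest _ (hfacet hab)).2 T (fun F hF => hF.1)
    ⟨{a, b}, ⟨hfacet hab, Relation.ReflTransGen.refl⟩, a, b, hab, rfl⟩
  have hT : ∀ x y, G.Adj x y → x ∈ F → ({x, y} : Finset (Fin n)) ∈ T := fun x y hxy hx =>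
    ⟨⟨hfacet hxy, hFc.2.tail ⟨hFc.1, hfacet hxy, x, hx, by simp⟩⟩, x, y, hxy, rfl⟩
  have hfin : ∀ x y, G.Adj x y → F = {x, y} → (∀ H ∈ T, x ∈ H → H = F) →
      ∃ v w, G.Adj v w ∧ ∀ u, G.Adj v u → u = w := by
    intro x y hxy hFxy hx
    refine ⟨x, y, hxy, fun u hu => ?_⟩
    have h1 := hx _ (hT x u hu (by simp [hFxy])) (by simp)
    rw [hFxy] at h1
    have h2 : u ∈ ({x, y} : Finset (Fin n)) := by rw [← h1]; simp
    rcases Finset.mem_insert.1 h2 with h | h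
    · exact absurd h hu.ne.symm
    · exact Finset.mem_singleton.1 h
  rcases hleaf with hleaf | ⟨F', hF', hne', hmeet⟩
  · exact hfin i j hij hF fun H hH _ => by rw [hleaf] at hH; exact hH
  -- Two distinct edges share at most one vertex. The end of `F` outside `F'` lies on no other edge
  -- of `T`, as `F ∩ H ⊆ F ∩ F'`, and is therefore a leaf of the graph.
  · have hout : i ∉ F' ∨ j ∉ F' := by
      by_contra! hcon
      obtain ⟨-, x, y, hxy, rfl⟩ := hF'
      refine hne' (Finset.eq_of_subset_of_card_le ?_ ?_).symm
      · rw [hF]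
        intro z hz
        rcases Finset.mem_insert.1 hz with rfl | hz
        · exact hcon.1
        · rw [Finset.mem_singleton.1 hz]; exact hcon.2
      · rw [hF, Finset.card_pair hij.ne, Finset.card_pair hxy.ne]
    rcases hout with h | h
    · refine hfin i j hij hF fun H hH hi => by_contra fun hHF => h ?_
      exact hmeet H hH hHF i (by simp [hF]) hi
    · refine hfin j i hij.symm (by rw [hF, Finset.pair_comm]) fun H hH hj =>
        by_contra fun hHF => h ?_
      exact hmeet H hH hHF j (by simp [hF]) hj

end EdgeIdeals

/-! ### Nonvanishing of products of star cycles. -/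

section MonomialCycles

variable {K : Type*} [Field K] {n : ℕ}

theorem smul_koszulBasis_eq (I : Ideal (MvPolynomial (Fin n) K))
    (r : MvPolynomial (Fin n) K ⧸ I) (L : Finset (Fin n)) :
    r • koszulBasis I L = algebraMap (MvPolynomial (Fin n) K ⧸ I)
      (ExteriorAlgebra _ (Fin n → MvPolynomial (Fin n) K ⧸ I)) r * wedgeBasis _ L :=
  Algebra.smul_def (R := MvPolynomial (Fin n) K ⧸ I) (A := ExteriorAlgebra _ _) r
    (wedgeBasis (MvPolynomial (Fin n) K ⧸ I) L)

theorem coord_algebraMap_mul {S : Type*} [CommRing S] (r : S)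
    (a : ExteriorAlgebra S (Fin n → S)) :
    coord (algebraMap S (ExteriorAlgebra S (Fin n → S)) r * a) = r • coord a := by
  rw [← Algebra.smul_def, map_smul]

/-- The element `x_w e_L` of the Koszul algebra, for a star with center `w` and rays `L`. -/
def starElement (I : Ideal (MvPolynomial (Fin n) K)) (t : Star n) : KoszulAlgebra I :=
  algebraMap (MvPolynomial (Fin n) K ⧸ I)
      (ExteriorAlgebra _ (Fin n → MvPolynomial (Fin n) K ⧸ I))
    (Ideal.Quotient.mk I (X t.center)) * wedgeBasis _ t.rays

/-- Each coefficient of the differential is, up to sign, a product `x_u x_w` of a ray and the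
center. -/
theorem starElement_mem_koszulCycles {I : Ideal (MvPolynomial (Fin n) K)} {t : Star n}
    (ht : ∀ u ∈ t.rays, (X u * X t.center : MvPolynomial (Fin n) K) ∈ I) :
    starElement I t ∈ koszulCycles I := by
  have h0 : coordD K (Ideal.Quotient.mk I (X t.center) •
      (Pi.single t.rays 1 : Finset (Fin n) → MvPolynomial (Fin n) K ⧸ I)) = 0 := by
    ext1 T
    rw [coordD_apply]
    refine Finset.sum_eq_zero fun s _ => ?_
    split_ifs with hs
    · exact smul_zero _
    · by_cases hL : insert s T = t.rays
      · rw [hL, Pi.smul_apply, Pi.single_eq_same, smul_comm, smul_eq_mul, mul_one]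
        have : (X s : MvPolynomial (Fin n) K) • Ideal.Quotient.mk I (X t.center) = 0 :=
          Ideal.Quotient.eq_zero_iff_mem.2 (ht s (by rw [← hL]; simp))
        rw [this, smul_zero]
      · rw [Pi.smul_apply, Pi.single_eq_of_ne hL, smul_zero, smul_zero, smul_zero]
  rw [mem_koszulCycles, ← ofCoord_coord (koszulD I _), coord_koszulD, starElement,
    coord_algebraMap_mul, coord_wedgeBasis, h0]
  exact map_zero _

theorem coe_list_prod_koszulCycles {I : Ideal (MvPolynomial (Fin n) K)} {j : ℕ}
    (z : Fin j → koszulCycles I) :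
    (((List.ofFn z).prod : koszulCycles I) : KoszulAlgebra I) =
      (List.ofFn fun a => (z a : KoszulAlgebra I)).prod := by
  refine (map_list_prod (koszulCycles I).val _).trans ?_
  rw [List.map_ofFn]
  rfl

/-- The union of the rays. -/
def allRays (ts : List (Star n)) : Finset (Fin n) :=
  ts.foldr (fun t A => t.rays ∪ A) ∅

theorem mem_allRays {ts : List (Star n)} {x : Fin n} :
    x ∈ allRays ts ↔ ∃ t ∈ ts, x ∈ t.rays := by
  induction ts with
  | nil => simp [allRays]
  | cons t ts ih =>
    rw [allRays, List.foldr_cons, Finset.mem_union]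
    change _ ∨ x ∈ allRays ts ↔ _
    rw [ih]
    simp

/-- The pairs `(center, leaf)`. -/
def starPairs (ts : List (Star n)) : List (Fin n × Fin n) := ts.map fun t => (t.center, t.leaf)

theorem smul_zsmul_single {S ι : Type*} [CommRing S] [DecidableEq ι] (c r : S) (a b : ℤ) (T : ι) :
    c • a • (Pi.single T (b • r) : ι → S) = Pi.single T (a • b • (c * r)) := by
  rw [← Pi.single_smul, ← Pi.single_smul, smul_eq_mul, mul_smul_comm, mul_smul_comm]

theorem coord_prod_starElement (I : Ideal (MvPolynomial (Fin n) K)) {H : SimpleGraph (Fin n)}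
    {ts : List (Star n)} (h : IsStarFamily H ts) :
    ∃ ε : ℤˣ, coord (ts.map (starElement I)).prod = Pi.single (allRays ts)
      ((ε : ℤ) • Ideal.Quotient.mk I (monomial (firstExponent (starPairs ts)) 1)) := by
  induction ts with
  | nil =>
    refine ⟨1, coord_one.trans ?_⟩
    have h1 : Ideal.Quotient.mk I (monomial (firstExponent (starPairs ([] : List (Star n)))) 1) =
        1 := map_one (Ideal.Quotient.mk I)
    rw [h1, Units.val_one, one_smul]
    rfl
  | cons t ts ih =>
    obtain ⟨ε, hε⟩ := ih h.2.2.2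
    have hdisj : Disjoint t.rays (allRays ts) := by
      refine Finset.disjoint_left.2 fun x hx hx' => ?_
      obtain ⟨s, hs, hxs⟩ := mem_allRays.1 hx'
      exact Finset.disjoint_left.1 (h.2.2.1 s hs).2 hx hxs
    obtain ⟨ε', hε'⟩ := coord_wedgeBasis_mul _ _ hdisj _ _ hε
    refine ⟨ε' * ε, ?_⟩
    rw [List.map_cons, List.prod_cons, starElement, mul_assoc, coord_algebraMap_mul, hε']
    have hf : (monomial (firstExponent (starPairs (t :: ts))) 1 : MvPolynomial (Fin n) K) =
        X t.center * monomial (firstExponent (starPairs ts)) 1 := by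
      rw [X, monomial_mul, one_mul]
      simp [starPairs, firstExponent]
    rw [hf, map_mul, smul_zsmul_single, Units.val_mul, mul_smul]
    rfl

/-- A transversal picks one end of each matching edge; as the matching is induced, its support
contains no edge. -/
theorem transversal_notMem {H : SimpleGraph (Fin n)} {ps : List (Fin n × Fin n)}
    (h : IsInducedMatching H ps) {m : Fin n →₀ ℕ} (hm : m ∈ transversals ps) :
    m ∉ graphUpperSet H ∅ := by
  induction ps generalizing m with
  | nil =>
    have hm0 : m = 0 := hm
    subst hm0
    rintro (⟨i, j, -, hi, -⟩ | ⟨s, hs, -⟩)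
    · exact hi rfl
    · simp at hs
  | cons p ps ih =>
    obtain ⟨m', hm', hmm⟩ := hm
    have key : ∀ x, (x = p.1 ∨ x = p.2) → m = Finsupp.single x 1 + m' →
        m ∉ graphUpperSet H ∅ := by
      rintro x hx rfl (⟨i, j, hij, hi, hj⟩ | ⟨s, hs, -⟩)
      · have hout : ∀ y, m' y ≠ 0 → ¬H.Adj x y := by
          intro y hy hxy
          obtain ⟨q, hq, hyq⟩ := exists_mem_of_mem_transversals hm' hy
          have := h.2.1 q hq
          rcases hx with rfl | rfl <;> rcases hyq with rfl | rfl <;> tauto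
        have hval : ∀ y, y ≠ x → (Finsupp.single x 1 + m' : Fin n →₀ ℕ) y = m' y :=
          fun y hy => by simp [hy.symm]
        by_cases hix : i = x
        · subst hix
          rw [hval j hij.ne.symm] at hj
          exact hout j hj hij
        by_cases hjx : j = x
        · subst hjx
          rw [hval i hix] at hi
          exact hout i hi hij.symm
        rw [hval i hix] at hi
        rw [hval j hjx] at hj
        exact ih h.2.2 hm' (Or.inl ⟨i, j, hij, hi, hj⟩)
      · simp at hs
    rcases hmm with hmm | hmm
    · exact key _ (Or.inl rfl) hmm
    · exact key _ (Or.inr rfl) hmm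

theorem exists_mapCoord_mk (I : Ideal (MvPolynomial (Fin n) K))
    (y : Finset (Fin n) → MvPolynomial (Fin n) K ⧸ I) :
    ∃ y', mapCoord (Submodule.mkQ I).toAddMonoidHom y' = y := by
  choose l hl using Submodule.mkQ_surjective I
  exact ⟨fun T => l (y T), by ext1 T; exact hl _⟩

theorem starFamily_not_boundary {H : SimpleGraph (Fin n)} {ts : List (Star n)}
    (h : IsStarFamily H ts) {I : Ideal (MvPolynomial (Fin n) K)}
    (hI : I = monomialIdeal K (graphUpperSet H ∅)) :
    ¬∃ y, coordD K y = coord (ts.map (starElement I)).prod := by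
  rintro ⟨y, hy⟩
  obtain ⟨ε, hε⟩ := coord_prod_starElement I h
  obtain ⟨y, rfl⟩ := exists_mapCoord_mk I y
  have hind : IsInducedMatching H (starPairs ts) := h.isInducedMatching
  obtain ⟨e, he⟩ : ∃ e, e = firstExponent (starPairs ts) := ⟨_, rfl⟩
  rw [← he] at hε
  -- Lifted to the polynomial ring, the relation holds up to an error `q` with values in `I`, whose
  -- coefficients at transversals vanish.
  let q : Finset (Fin n) → MvPolynomial (Fin n) K :=
    Pi.single (allRays ts) (monomial e ((ε : ℤ) : K)) - coordD K y
  have hq : ∀ T m, m ∈ transversals (starPairs ts) → coeff m (q T) = 0 := by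
    intro T m hm
    have hqT : q T ∈ I := by
      rw [← Submodule.Quotient.mk_eq_zero I]
      have h1 := congrFun (hy.trans hε) T
      rw [coordD_mapCoord, mapCoord_apply] at h1
      have h2 : Submodule.mkQ I (coordD K y T) =
          (Pi.single (allRays ts) ((ε : ℤ) • Ideal.Quotient.mk I (monomial e 1)) :
            Finset (Fin n) → MvPolynomial (Fin n) K ⧸ I) T := h1
      change Submodule.mkQ I (q T) = 0
      have hqT : q T = (Pi.single (allRays ts) (monomial e ((ε : ℤ) : K)) :
          Finset (Fin n) → MvPolynomial (Fin n) K) T - coordD K y T := rfl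
      rw [hqT, map_sub, h2, sub_eq_zero]
      by_cases hT : T = allRays ts
      · subst hT
        rw [Pi.single_eq_same, Pi.single_eq_same, ← map_zsmul, ← map_zsmul (monomial e),
          zsmul_one]
        rfl
      · rw [Pi.single_eq_of_ne hT, Pi.single_eq_of_ne hT, map_zero]
    by_contra hne
    rw [hI] at hqT
    exact transversal_notMem hind hm (hqT m hne)
  have hV : secondSet (starPairs ts) ⊆ allRays ts := by
    intro x hx
    obtain ⟨p, hp, rfl⟩ := List.mem_map.1 (List.mem_toFinset.1 hx)
    obtain ⟨t, ht, rfl⟩ := List.mem_map.1 hp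
    have hleaf : ∀ (us : List (Star n)), IsStarFamily H us → ∀ t ∈ us, t.leaf ∈ t.rays := by
      intro us hus
      induction us with
      | nil => simp
      | cons u us ih =>
        intro t ht
        rcases List.mem_cons.1 ht with rfl | ht
        · exact hus.1
        · exact ih hus.2.2.2 t ht
    exact mem_allRays.2 ⟨t, ht, hleaf ts h t ht⟩
  -- All rays other than the chosen leaves are contracted away, leaving the monomial cycle of the
  -- induced matching.
  obtain ⟨ε', y', q', hq', h'⟩ := exists_boundary_of_union (· ∈ transversals (starPairs ts))
    (secondSet (starPairs ts)) (allRays ts \ secondSet (starPairs ts)) Finset.sdiff_disjoint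
    (monomial e ((ε : ℤ) : K)) y q hq (by rw [Finset.sdiff_union_of_subset hV]; simp [q])
  have h0 := matchingFunctional_boundary hind y' q' hq'
  rw [← h', ← map_zsmul (monomial e), he] at h0
  have h1 := matchingFunctional_single hind h0
  -- The detected scalar is a sign, hence nonzero in every characteristic.
  rcases Int.units_eq_one_or ε with rfl | rfl <;> rcases Int.units_eq_one_or ε' with rfl | rfl <;>
    simp at h1

/-- The linear monomial cycles of a family of stars have nonzero product. -/
theorem exists_cycles_of_starFamily {H : SimpleGraph (Fin n)} {i j : Fin n} (hij : H.Adj i j)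
    {ts : List (Star n)} (h : IsStarFamily H ts) {I : Ideal (MvPolynomial (Fin n) K)}
    (hI : I = monomialIdeal K (graphUpperSet H ∅)) :
    ∃ z : Fin ts.length → koszulCycles I,
      (∀ a, IsLinearMonomialCycle I (z a) ∧ HasHomologicalDegree I (ts.get a).rays.card (z a)) ∧
      (List.ofFn fun a => homologyClass I (z a)).prod ≠ 0 := by
  have hadj : ∀ (us : List (Star n)), IsStarFamily H us → ∀ t ∈ us, ∀ u ∈ t.rays,
      H.Adj t.center u := by
    intro us hus
    induction us with
    | nil => simp
    | cons u us ih =>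
      intro t ht
      rcases List.mem_cons.1 ht with rfl | ht
      · exact hus.2.1
      · exact ih hus.2.2.2 t ht
  have hcyc : ∀ a : Fin ts.length, starElement I (ts.get a) ∈ koszulCycles I := by
    intro a
    refine starElement_mem_koszulCycles fun u hu => ?_
    rw [X, X, monomial_mul, one_mul, hI, monomial_mem_monomialIdeal]
    exact Or.inl ⟨u, (ts.get a).center, (hadj ts h _ (List.get_mem ts a) u hu).symm, by simp,
      by simp⟩
  refine ⟨fun a => ⟨_, hcyc a⟩, fun a => ⟨⟨Finsupp.single (ts.get a).center 1, (ts.get a).rays,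
    ?_, ?_⟩, ?_⟩, ?_⟩
  · rw [hI, leastGeneratorDegree_graph hij, Finsupp.degree_single]
  · rw [smul_koszulBasis_eq]
    rfl
  · change starElement I _ ∈ _
    rw [starElement, ← Algebra.smul_def]
    exact Submodule.smul_mem _ _ (wedgeBasis_mem_exteriorPower _)
  · rw [prod_homologyClass, Ne, homologyClass_eq_zero_iff]
    have hprod : (List.ofFn fun a => starElement I (ts.get a)).prod =
        (ts.map (starElement I)).prod := by
      congr 1
      conv_rhs => rw [← List.ofFn_get ts, List.map_ofFn]
      rfl
    rw [coe_list_prod_koszulCycles, hprod]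
    exact starFamily_not_boundary h hI

end MonomialCycles

/-! ### Upper bounds for products of linear monomial cycles. -/

section UpperBounds

universe u

variable {K : Type u} [Field K] {n : ℕ}

/-- Scalars are central, so the degree-one monomials can be collected in front; only the degree of
their product matters. -/
theorem prod_monomialCycles {I : Ideal (MvPolynomial (Fin n) K)} (hd : leastGeneratorDegree I = 2)
    {j : ℕ} (z : Fin j → koszulCycles I) (hz : ∀ a, IsLinearMonomialCycle I (z a)) :
    ∃ (m : Fin n →₀ ℕ) (b : ExteriorAlgebra (MvPolynomial (Fin n) K ⧸ I)
        (Fin n → MvPolynomial (Fin n) K ⧸ I)),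
      m.degree = j ∧ (((List.ofFn z).prod : koszulCycles I) : KoszulAlgebra I) =
        algebraMap _ (ExteriorAlgebra (MvPolynomial (Fin n) K ⧸ I)
          (Fin n → MvPolynomial (Fin n) K ⧸ I)) (Ideal.Quotient.mk I (monomial m 1)) * b := by
  induction j with
  | zero => exact ⟨0, 1, by simp, by simp⟩
  | succ j ih =>
    obtain ⟨m, b, hm, hb⟩ := ih (fun a => z a.succ) fun a => hz a.succ
    obtain ⟨m', L, hm', hL⟩ := hz 0
    refine ⟨m' + m, wedgeBasis _ L * b, by rw [map_add]; omega, ?_⟩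
    have hmm : (monomial (m' + m) 1 : MvPolynomial (Fin n) K) = monomial m' 1 * monomial m 1 := by
      rw [monomial_mul, one_mul]
    rw [List.ofFn_succ, List.prod_cons, Subalgebra.coe_mul, hb, hL, smul_koszulBasis_eq, hmm,
      map_mul, map_mul, mul_assoc, mul_assoc, ← mul_assoc (wedgeBasis _ L), ← Algebra.commutes,
      mul_assoc]

/-- The product lifts to a vector divisible by a monomial of degree `j`; if `j > r`, all its
coefficients lie in the range where homology vanishes. -/
theorem le_of_koszulVanishesAbove {U : UpperSet (Fin n →₀ ℕ)} {r : ℕ}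
    (h : KoszulVanishesAbove K U r) {I : Ideal (MvPolynomial (Fin n) K)}
    (hI : I = monomialIdeal K U) (hd : leastGeneratorDegree I = 2)
    {j : ℕ} (z : Fin j → koszulCycles I) (hz : ∀ a, IsLinearMonomialCycle I (z a))
    (hne : (List.ofFn fun a => homologyClass I (z a)).prod ≠ 0) : j ≤ r := by
  by_contra! hj
  refine hne ?_
  rw [prod_homologyClass, homologyClass_eq_zero_iff]
  obtain ⟨m, b, hm, hb⟩ := prod_monomialCycles hd z hz
  obtain ⟨w, hw⟩ := exists_mapCoord_mk I (coord b)
  have hP : mapCoord (Submodule.mkQ I).toAddMonoidHom (monomial m (1 : K) • w) =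
      coord (((List.ofFn z).prod : koszulCycles I) : KoszulAlgebra I) := by
    rw [hb, coord_algebraMap_mul, ← hw]
    rfl
  have hdeg : ∀ T m', coeff m' ((monomial m (1 : K) • w :
      Finset (Fin n) → MvPolynomial (Fin n) K) T) ≠ 0 → r < m'.degree := by
    intro T m' hm'
    rw [Pi.smul_apply, smul_eq_mul, coeff_monomial_mul'] at hm'
    split_ifs at hm' with hle
    · rw [← tsub_add_cancel_of_le hle, map_add]
      omega
    · exact absurd rfl hm'
  have hcyc : ∀ T, coordD K (monomial m (1 : K) • w) T ∈ monomialIdeal K U := by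
    intro T
    have h1 := congrFun (coordD_mapCoord (K := K) (Submodule.mkQ I) (monomial m (1 : K) • w)) T
    rw [hP, coordD_coord_cycle] at h1
    rw [← hI]
    exact (Submodule.Quotient.mk_eq_zero I).1 h1.symm
  obtain ⟨y, hy⟩ := h _ hdeg hcyc
  refine ⟨mapCoord (Submodule.mkQ I).toAddMonoidHom y, ?_⟩
  rw [coordD_mapCoord, ← hP]
  ext1 T
  rw [← hI] at hy
  exact ((Submodule.Quotient.eq I).2 (hy T)).symm

-- The product is concentrated in homological degree `∑ k a`, so it is a boundary as soon as this
-- degree is at least `p`.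
open CategoryTheory in
theorem lt_of_hasProjectiveDimensionLT {I : Ideal (MvPolynomial (Fin n) K)} {p : ℕ}
    (h : HasProjectiveDimensionLT (ModuleCat.of (MvPolynomial (Fin n) K)
      (MvPolynomial (Fin n) K ⧸ I)) p)
    {j : ℕ} (z : Fin j → koszulCycles I) (k : Fin j → ℕ)
    (hz : ∀ a, HasHomologicalDegree I (k a) (z a))
    (hne : (List.ofFn fun a => homologyClass I (z a)).prod ≠ 0) : ∑ a, k a < p := by
  by_contra! hj
  refine hne ?_
  rw [prod_homologyClass, homologyClass_eq_zero_iff]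
  refine exists_coordD_eq_of_hasProjectiveDimensionLT p _ h _ (coordD_coord_cycle I _)
    fun T hT => ?_
  refine coord_apply_eq_zero_of_mem_exteriorPower (∑ a, k a) _ ?_ T (by omega)
  rw [coe_list_prod_koszulCycles]
  exact list_prod_mem_exteriorPower _ _ hz

end UpperBounds

end FacetIdeal

end

theorem corollary2p12 (K : Type*) [Field K] (n : ℕ) (Δ : AbstractSimplicialComplex (Fin n))
    (hdim : FacetIdeal.HasDimension Δ 1) (hforest : FacetIdeal.IsForest Δ)
    (I : Ideal (MvPolynomial (Fin n) K)) (hI : I = FacetIdeal.edgeIdeal K Δ) :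
    (∃ r : ℕ, FacetIdeal.HasRegularity I (r : ℤ) ∧
      IsGreatest {j : ℕ | ∃ z : Fin j → FacetIdeal.koszulCycles I,
        (∀ a, FacetIdeal.IsLinearMonomialCycle I (z a)) ∧
        (List.ofFn fun a => FacetIdeal.homologyClass I (z a)).prod ≠ 0} r) ∧
    (∃ p : ℕ, CategoryTheory.projectiveDimension
        (ModuleCat.of (MvPolynomial (Fin n) K) (MvPolynomial (Fin n) K ⧸ I)) = p ∧
      IsGreatest {s : ℕ | ∃ (j : ℕ) (z : Fin j → FacetIdeal.koszulCycles I) (k : Fin j → ℕ),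
        (∀ a, FacetIdeal.IsLinearMonomialCycle I (z a) ∧
          FacetIdeal.HasHomologicalDegree I (k a) (z a)) ∧
        (List.ofFn fun a => FacetIdeal.homologyClass I (z a)).prod ≠ 0 ∧
        s = ∑ a, k a} p) := by
  replace hI := hI.trans (FacetIdeal.edgeIdeal_eq_monomialIdeal Δ)
  obtain ⟨i, j, hij⟩ := FacetIdeal.exists_edge_of_hasDimension hdim
  have hd : FacetIdeal.leastGeneratorDegree I = 2 := by
    rw [hI, FacetIdeal.leastGeneratorDegree_graph hij]
  obtain ⟨r, p, hinv, ⟨ts, hts, hr⟩, ⟨us, hus, hp⟩⟩ :=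
    FacetIdeal.exists_hasInvariants_and_starFamily (K := K) (FacetIdeal.edgeGraph Δ)
      (FacetIdeal.exists_leaf_of_isForest hdim hforest)
  have hlt := hinv.hasProjectiveDimensionLT
  rw [← hI] at hlt
  obtain ⟨z, hz, hne⟩ := FacetIdeal.exists_cycles_of_starFamily hij hus hI
  have hsum : p = ∑ a : Fin us.length, (us.get a).rays.card := by
    rw [← hp, ← List.sum_ofFn]
    congr 1
    conv_lhs => rw [← List.ofFn_get us, List.map_ofFn]
    rfl
  refine ⟨⟨r, ?_, ?_, ?_⟩, p, le_antisymm ?_ ?_, ?_, ?_⟩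
  · obtain ⟨F, hF⟩ := hinv.exists_resolution
    rw [hI]
    exact F.hasRegularity hF
  · subst hr
    obtain ⟨z, hz, hne⟩ := FacetIdeal.exists_cycles_of_starFamily hij hts hI
    exact ⟨z, fun a => (hz a).1, hne⟩
  · rintro j ⟨z, hz, hne⟩
    exact FacetIdeal.le_of_koszulVanishesAbove hinv.koszulVanishesAbove hI hd z hz hne
  · exact (CategoryTheory.projectiveDimension_le_iff _ _).2 hlt
  -- A smaller projective dimension would make homology vanish in degree `p`, where the product of
  -- the star cycles is nonzero.
  · refine (CategoryTheory.projectiveDimension_ge_iff _ _).2 fun h => ?_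
    have := FacetIdeal.lt_of_hasProjectiveDimensionLT h z _ (fun a => (hz a).2) hne
    omega
  · exact ⟨us.length, z, _, hz, hne, hsum⟩
  · rintro s ⟨j, z, k, hz, hne, rfl⟩
    exact Nat.lt_succ_iff.1
      (FacetIdeal.lt_of_hasProjectiveDimensionLT hlt z k (fun a => (hz a).2) hne)
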